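/- Let $f_0(z)=e^{z/(1-z)}$ and $f_1(z)=e^{x}E_1(x)$ with $x=1/(1-z)$, where $E_1(x)=\int_x^\infty t^{-1}e^{-t}\,dt$. Let $a_n=[z^n]f_0(z)$ and $b_n=[z^n]f_1(z)$ be their Maclaurin coefficients, and put $\rho_n=a_nb_n$. Let $\mu(h)=h^{-1}-(e^h-1)^{-1}-\tfrac12$ (with $\mu(0)=0$, its limit at $0$), and for $m,k\ge 0$ define \[ c_m=(-1)^m\sum_{j=0}^m [h^{m-j}]\exp(\mu(h))\;\frac{(m-2j+3/2)_{2j}}{4^j\,j!},\qquad d_k=\sum_{j=0}^{2k}(-1)^jc_jc_{2k-j}, \] where $(x)_n=x(x+1)\cdots(x+n-1)$ and $[h^n]f(h)$ denotes the $n$-th Maclaurin coefficient of $f$. Then the $d_k$ are the coefficients of the asymptotic series (in the sense of Poincar\'e) \[ \rho_n\sim-\frac{1}{2n^{3/2}}\sum_{k\ge0}d_kn^{-k}\qquad(n\to\infty), \] and we have $d_0=1$ and, for all $k\ge 1$, \[ 8k\,d_k=-[h^{k+2}]\sum_{j=0}^{k-1}d_jh^j\Big(B(h)(1-h)^{-(j+1/2)}+C(h)(1-2h)^{-(j+1/2)}+D(h)(1-3h)^{-(j+1/2)}\Big),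 \] where \[ \begin{aligned} B(h)&=-6+13h-7h^2+h^3=-(2-h)(3-5h+h^2),\\ C(h)&=6-19h+17h^2-3h^3=(2-3h)(3-5h+h^2),\\ D(h)&=-2+11h-17h^2+6h^3=-(1-2h)(1-3h)(2-h). \end{aligned} \] -/

import Mathlib

open Asymptotics Filter

noncomputable section

namespace BGG

/-- `[h^n] f(h)`: the `n`-th Maclaurin coefficient of a real function that is smooth near `0`. -/
def coeffAtZero (n : ℕ) (f : ℝ → ℝ) : ℝ :=
  iteratedDeriv n f 0 / (n.factorial : ℝ)

/-- `f(n) ∼ ∑ d_k n^{-k}` as `n → ∞`, in the sense of Poincaré: for every fixed `m > 0`,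
`f(n) = ∑_{k < m} d_k n^{-k} + O(n^{-m})`. -/
def HasPoincareExpansion (f : ℕ → ℝ) (d : ℕ → ℝ) : Prop :=
  ∀ m : ℕ, 0 < m →
    (fun n : ℕ => f n - ∑ k ∈ Finset.range m, d k / (n : ℝ) ^ k)
      =O[atTop] (fun n : ℕ => 1 / (n : ℝ) ^ m)

/-- The exponential integral `E₁(x) = ∫_x^∞ e^{-t} / t dt`, for `x > 0`. -/
def E₁ (x : ℝ) : ℝ :=
  ∫ t in Set.Ioi x, Real.exp (-t) / t

/-- `f₀(z) = exp(z / (1 - z))`. -/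
def f₀ (z : ℝ) : ℝ :=
  Real.exp (z / (1 - z))

/-- `f₁(z) = e^x E₁(x)` where `x = 1 / (1 - z)`. -/
def f₁ (z : ℝ) : ℝ :=
  Real.exp (1 / (1 - z)) * E₁ (1 / (1 - z))

/-- The Maclaurin coefficients of `f₀`. -/
def a (n : ℕ) : ℝ := coeffAtZero n f₀

/-- The Maclaurin coefficients of `f₁`. -/
def b (n : ℕ) : ℝ := coeffAtZero n f₁

/-- The coefficients of the Hadamard product of `f₀` and `f₁`. -/
def ρ (n : ℕ) : ℝ := a n * b n

/-- `μ(h) = 1/h - 1/(e^h - 1) - 1/2`, with its removable singularity at `0` filled in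
(the limit at `0` is `0`). -/
def μ (h : ℝ) : ℝ :=
  if h = 0 then 0 else 1 / h - 1 / (Real.exp h - 1) - 1 / 2

/-- `c_m = (-1)^m ∑_{j=0}^m [h^{m-j}] exp(μ(h)) · (m - 2j + 3/2)_{2j} / (4^j j!)`,
where `(x)_n` is the ascending factorial. -/
def c (m : ℕ) : ℝ :=
  (-1) ^ m * ∑ j ∈ Finset.range (m + 1),
    coeffAtZero (m - j) (fun h => Real.exp (μ h)) *
      ((ascPochhammer ℝ (2 * j)).eval ((m : ℝ) - 2 * (j : ℝ) + 3 / 2) /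
        (4 ^ j * (j.factorial : ℝ)))

/-- `d_k = ∑_{j=0}^{2k} (-1)^j c_j c_{2k-j}`. -/
def d (k : ℕ) : ℝ :=
  ∑ j ∈ Finset.range (2 * k + 1), (-1) ^ j * c j * c (2 * k - j)

/-- The cubic polynomial `B(h)`. -/
def B (h : ℝ) : ℝ := -6 + 13 * h - 7 * h ^ 2 + h ^ 3

/-- The cubic polynomial `C(h)`. -/
def C (h : ℝ) : ℝ := 6 - 19 * h + 17 * h ^ 2 - 3 * h ^ 3

/-- The cubic polynomial `D(h)`. -/
def D (h : ℝ) : ℝ := -2 + 11 * h - 17 * h ^ 2 + 6 * h ^ 3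

end BGG

end

open Topology Finset MeasureTheory

/-! Put n = s². Under z = e^{-h} one has z/(1-z) = 1/(e^h-1), and both coefficient sequences become
integrals of one exponential: b n = -∫_0^∞ exp(-nh - 1/(e^h-1)) dh for n ≥ 1 (`b_eq`), and 2πi a n =
∮ exp(nh + 1/(e^h-1)) dh over a small circle around 0 (`circleIntegral_contourIntegrand_eq`).

Since 1/(e^h-1) = 1/h - 1/2 - μ(h), expanding exp(±μ) at h = 0 turns these integrals into asymptotic
series of Bessel functions K_{i+1}(2s) and I_{i+1}(2s) (`hasExpansion_laplace`,
`hasExpansion_circleMean`). The substitutions w = 2 sinh(u/2) and w = 2 sin(φ/2) make the Bessel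
integrals Gaussian, with one and the same kernel taken at w² and at -w². Watson's lemma
(`HasExpansion.gaussian_integral`) then gives expansions in 1/s whose coefficients differ by (-1)^j.
Because μ is odd, the coefficients of exp(μ) and exp(-μ) also differ by (-1)^i. After normalization
a n has coefficients c m, and -b n has (-1)^m c m. In the product the factors e^{±2s} and e^{±1/2}
cancel; the Cauchy product vanishes at odd orders by symmetry and equals d k at order 2k. Hence the
series is in powers of 1/s² = 1/n (`hasExpansion_normρ`).

For the recursion, a and b satisfy the same second-order recurrence, so ρ satisfies one of third
order (`ρ_recurrence`). Inserting the expansion and using uniqueness of coefficients gives a linear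
relation among the d j at each order (`sum_d_mul_coeff_eq_zero`). At order k+2 the coefficients of d
(k+2) and d (k+1) cancel, that of d k is 8k, and the unshifted term, a quadratic polynomial in 1/n,
does not touch the d j with j < k (`eight_mul_d`). -/

/-! ### Calculus of Poincaré expansions. -/

/-- `f ∼ ∑ c m * t ^ m` along `l`, in the sense of Poincaré. -/
def HasExpansion {ι 𝕜 : Type*} [NormedField 𝕜] (l : Filter ι) (t f : ι → 𝕜) (c : ℕ → 𝕜) : Prop :=
  ∀ M : ℕ, (fun x => f x - ∑ m ∈ range M, c m * t x ^ m) =O[l] fun x => t x ^ M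

namespace HasExpansion

variable {ι κ 𝕜 : Type*} [NormedField 𝕜] {l : Filter ι} {t f g : ι → 𝕜} {c c' : ℕ → 𝕜}

theorem congr' (h : HasExpansion l t f c) (hfg : f =ᶠ[l] g) : HasExpansion l t g c := fun M =>
  (h M).congr' (hfg.mono fun x hx => by simp [hx]) EventuallyEq.rfl

theorem mono (h : HasExpansion l t f c) {l' : Filter ι} (hl : l' ≤ l) : HasExpansion l' t f c :=
  fun M => (h M).mono hl

theorem comp_tendsto (h : HasExpansion l t f c) {l' : Filter κ} {φ : κ → ι}
    (hφ : Tendsto φ l' l) : HasExpansion l' (fun x => t (φ x)) (fun x => f (φ x)) c :=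
  fun M => (h M).comp_tendsto hφ

theorem isBigO_one (h : HasExpansion l t f c) : f =O[l] fun _ => (1 : 𝕜) := by
  simpa using h 0

theorem add (hf : HasExpansion l t f c) (hg : HasExpansion l t g c') :
    HasExpansion l t (fun x => f x + g x) (fun m => c m + c' m) := fun M =>
  ((hf M).add (hg M)).congr_left fun x => by
    simp only [add_mul, sum_add_distrib]; ring

theorem const_mul (hf : HasExpansion l t f c) (k : 𝕜) :
    HasExpansion l t (fun x => k * f x) (fun m => k * c m) := fun M =>
  ((hf M).const_mul_left k).congr_left fun x => by
    simp only [mul_sub, mul_sum, mul_assoc]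

theorem neg (hf : HasExpansion l t f c) : HasExpansion l t (fun x => -f x) (fun m => -c m) := by
  simpa using hf.const_mul (-1)

theorem sub (hf : HasExpansion l t f c) (hg : HasExpansion l t g c') :
    HasExpansion l t (fun x => f x - g x) (fun m => c m - c' m) := by
  simpa [sub_eq_add_neg] using hf.add hg.neg

theorem zero : HasExpansion l t (fun _ => 0) (fun _ => 0) := fun M => by
  simpa using isBigO_zero _ _

theorem finset_sum {α : Type*} (s : Finset α) {F : α → ι → 𝕜} {C : α → ℕ → 𝕜}
    (h : ∀ i ∈ s, HasExpansion l t (F i) (C i)) :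
    HasExpansion l t (fun x => ∑ i ∈ s, F i x) (fun m => ∑ i ∈ s, C i m) := by
  classical
  induction s using Finset.induction_on with
  | empty => simpa using zero
  | insert i s hi ih =>
    simp only [sum_insert hi]
    exact (h i (mem_insert_self i s)).add (ih fun j hj => h j (mem_insert_of_mem hj))

/-- Substitution of asymptotic expansions into an expansion with varying coefficients. -/
theorem of_forall_isBigO {F : ι → 𝕜} {e : ℕ → 𝕜} {g : ℕ → ι → 𝕜} {q : ℕ → ℕ → 𝕜}
    (hF : ∀ M : ℕ, (fun x => F x - ∑ i ∈ range M, e i * t x ^ i * g i x) =O[l] fun x => t x ^ M)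
    (hg : ∀ i, HasExpansion l t (g i) (q i)) :
    HasExpansion l t F (fun m => ∑ i ∈ range (m + 1), e i * q i (m - i)) := by
  intro M
  have h2 : (fun x => ∑ i ∈ range M, e i * (t x ^ i *
      (g i x - ∑ j ∈ range (M - i), q i j * t x ^ j))) =O[l] fun x => t x ^ M := by
    refine IsBigO.fun_sum fun i hi => IsBigO.const_mul_left ?_ _
    have := (isBigO_refl (fun x => t x ^ i) l).mul (hg i (M - i))
    refine this.congr_right fun x => ?_
    rw [← pow_add, Nat.add_sub_cancel' (mem_range.1 hi).le]
  refine ((hF M).add h2).congr_left fun x => ?_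
  -- The pairs with i < M and j < M - i are those with i + j < M; summing along diagonals collects
  -- the coefficient of each power of t.
  have h3 := sum_range_diag_flip M fun i j => e i * q i j * t x ^ (i + j)
  have h4 : ∑ m ∈ range M, (∑ i ∈ range (m + 1), e i * q i (m - i)) * t x ^ m =
      ∑ m ∈ range M, ∑ k ∈ range (m + 1), e k * q k (m - k) * t x ^ (k + (m - k)) := by
    refine sum_congr rfl fun m _ => ?_
    rw [sum_mul]
    refine sum_congr rfl fun k hk => ?_
    rw [Nat.add_sub_cancel' (Nat.lt_succ_iff.1 (mem_range.1 hk))]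
  rw [h4, h3, sub_add, sub_right_inj, ← sum_sub_distrib]
  refine sum_congr rfl fun i _ => ?_
  rw [mul_sub, mul_sub, mul_sum, mul_sum, ← mul_assoc, sub_sub_cancel]
  refine sum_congr rfl fun j _ => ?_
  ring

theorem mul (hf : HasExpansion l t f c) (hg : HasExpansion l t g c') :
    HasExpansion l t (fun x => f x * g x) (fun m => ∑ i ∈ range (m + 1), c i * c' (m - i)) := by
  refine of_forall_isBigO (g := fun _ => g) (q := fun _ => c') (fun M => ?_) fun _ => hg
  refine ((hf M).mul hg.isBigO_one).congr (fun x => ?_) fun x => mul_one _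
  rw [sub_mul, sum_mul]

theorem var_mul (ht : t =O[l] fun _ => (1 : 𝕜)) (hf : HasExpansion l t f c) :
    HasExpansion l t (fun x => t x * f x) (fun m => if m = 0 then 0 else c (m - 1)) := by
  rintro (_ | M)
  · simpa using ht.mul hf.isBigO_one
  · refine ((isBigO_refl t l).mul (hf M)).congr (fun x => ?_) fun x => by ring
    rw [sum_range_succ']
    simp only [mul_sub, mul_sum, add_tsub_cancel_right, Nat.add_eq_zero_iff, one_ne_zero, and_false,
      if_false, if_true, zero_mul, add_zero]
    congr 1
    exact sum_congr rfl fun j _ => by ring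

theorem pow_mul (ht : t =O[l] fun _ => (1 : 𝕜)) (hf : HasExpansion l t f c) (k : ℕ) :
    HasExpansion l t (fun x => t x ^ k * f x) (fun m => if m < k then 0 else c (m - k)) := by
  induction k with
  | zero => simpa using hf
  | succ k ih =>
    convert var_mul ht ih using 2 with x m
    · ring
    · rcases m with _ | m
      · simp
      · simp

/-- If the coefficients agree below m, subtracting the two expansions at order m + 1 leaves (c m -
c' m) t^m = O(t^{m+1}); dividing by t^m forces the constant to be 0. -/
theorem unique [l.NeBot] (ht : Tendsto t l (𝓝 0)) (ht0 : ∀ᶠ x in l, t x ≠ 0)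
    (h : HasExpansion l t f c) (h' : HasExpansion l t f c') : c = c' := by
  funext m
  induction m using Nat.strong_induction_on with
  | _ m ih =>
    have h1 : (fun x => (c m - c' m) * t x ^ m) =O[l] fun x => t x ^ (m + 1) := by
      refine ((h' (m + 1)).sub (h (m + 1))).congr_left fun x => ?_
      rw [sum_range_succ, sum_range_succ,
        sum_congr rfl fun i hi => by rw [← ih i (mem_range.1 hi)]]
      ring
    have h2 : (fun x => t x ^ (m + 1)) =o[l] fun x => t x ^ m := by
      have := (isBigO_refl (fun x => t x ^ m) l).mul_isLittleO ((isLittleO_one_iff 𝕜).2 ht)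
      simpa [pow_succ] using this
    have h3 : (fun _ : ι => c m - c' m) =o[l] fun _ => (1 : 𝕜) := by
      have := (h1.trans_isLittleO h2).mul_isBigO (isBigO_refl (fun x => (t x ^ m)⁻¹) l)
      refine this.congr' ?_ ?_ <;> filter_upwards [ht0] with x hx <;> field_simp
    rw [isLittleO_const_const_iff] at h3
    simpa [sub_eq_zero] using h3

end HasExpansion

theorem AnalyticAt.hasExpansion {𝕜 : Type*} [RCLike 𝕜] {f : 𝕜 → 𝕜} (hf : AnalyticAt 𝕜 f 0) :
    HasExpansion (𝓝 0) (fun x => x) f (fun n => iteratedDeriv n f 0 / (n.factorial : 𝕜)) := by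
  intro M
  have h := hf.hasFPowerSeriesAt.isBigO_sub_partialSum_pow M
  simp only [zero_add, FormalMultilinearSeries.partialSum,
    FormalMultilinearSeries.ofScalars_apply_eq, smul_eq_mul] at h
  refine (h.trans (IsBigO.of_norm_right ?_))
  simpa using isBigO_refl _ _

theorem BGG.hasExpansion_coeffAtZero {f : ℝ → ℝ} (hf : AnalyticAt ℝ f 0) :
    HasExpansion (𝓝 0) (fun x => x) f (fun n => BGG.coeffAtZero n f) :=
  hf.hasExpansion

theorem HasExpansion.unique_nhds_zero {f : ℝ → ℝ} {c c' : ℕ → ℝ}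
    (h : HasExpansion (𝓝[>] 0) (fun x => x) f c) (h' : HasExpansion (𝓝[>] 0) (fun x => x) f c') :
    c = c' :=
  h.unique (show Tendsto (fun x : ℝ => x) (𝓝[>] 0) (𝓝 0) from nhdsWithin_le_nhds)
    (eventually_mem_nhdsWithin.mono fun _ hx => ne_of_gt hx) h'

/-- By uniqueness, Maclaurin coefficients can be read off any expansion, without computing iterated
derivatives. Approaching from the right suffices and keeps the variable nonzero. -/
theorem BGG.coeffAtZero_eq {f : ℝ → ℝ} {c : ℕ → ℝ} (hf : AnalyticAt ℝ f 0)
    (h : HasExpansion (𝓝[>] 0) (fun x => x) f c) (n : ℕ) : BGG.coeffAtZero n f = c n :=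
  congrFun (((BGG.hasExpansion_coeffAtZero hf).mono nhdsWithin_le_nhds).unique_nhds_zero h) n

/-! ### The common kernel of the Bessel integrals. -/

/-- The function `cosh (ν u) / cosh (u / 2)` in the variable `x = (2 sinh (u / 2)) ^ 2`. -/
noncomputable def coshKernel (ν : ℕ) (x : ℝ) : ℝ :=
  (Polynomial.Chebyshev.T ℝ ν).eval (1 + x / 2) * (1 + x / 4) ^ (-1 / 2 : ℝ)

/-- The Maclaurin coefficients of `coshKernel ν`. -/
noncomputable def coshKernelCoeff (ν j : ℕ) : ℝ :=
  (ascPochhammer ℝ (2 * j)).eval ((ν : ℝ) - j + 1 / 2) / ((2 * j).factorial : ℝ)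

theorem coshKernel_add_two (ν : ℕ) (x : ℝ) :
    coshKernel (ν + 2) x = (2 + x) * coshKernel (ν + 1) x - coshKernel ν x := by
  have := Polynomial.Chebyshev.T_add_two ℝ ν
  simp only [coshKernel, Nat.cast_add, Nat.cast_ofNat, Nat.cast_one, this]
  simp
  ring

theorem coshKernel_zero (x : ℝ) : coshKernel 0 x = (1 + x / 4) ^ (-1 / 2 : ℝ) := by
  simp [coshKernel]

theorem coshKernel_one (x : ℝ) : coshKernel 1 x = (1 + x / 2) * coshKernel 0 x := by
  simp [coshKernel]

theorem ascPochhammer_eval_succ_left (x : ℝ) (n : ℕ) :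
    (ascPochhammer ℝ (n + 1)).eval x = x * (ascPochhammer ℝ n).eval (x + 1) := by
  simp [ascPochhammer_succ_left]

theorem coshKernelCoeff_zero_right (ν : ℕ) : coshKernelCoeff ν 0 = 1 := by
  simp [coshKernelCoeff]

/-- This is `coshKernel_add_two` on coefficients. With z = ν - j + 3/2 the four rising factorials
share the block (z)_{2j}, and a polynomial identity remains. -/
theorem coshKernelCoeff_add_two (ν j : ℕ) :
    coshKernelCoeff (ν + 2) (j + 1) = 2 * coshKernelCoeff (ν + 1) (j + 1) +
      coshKernelCoeff (ν + 1) j - coshKernelCoeff ν (j + 1) := by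
  set z : ℝ := (ν : ℝ) - j + 3 / 2 with hz
  have e1 : ((ν + 2 : ℕ) : ℝ) - ((j + 1 : ℕ) : ℝ) + 1 / 2 = z := by push_cast; rw [hz]; ring
  have e2 : ((ν + 1 : ℕ) : ℝ) - ((j + 1 : ℕ) : ℝ) + 1 / 2 = z - 1 := by push_cast; rw [hz]; ring
  have e3 : ((ν + 1 : ℕ) : ℝ) - (j : ℝ) + 1 / 2 = z := by push_cast; rw [hz]; ring
  have e4 : (ν : ℝ) - ((j + 1 : ℕ) : ℝ) + 1 / 2 = z - 2 := by push_cast; rw [hz]; ring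
  simp only [coshKernelCoeff]
  rw [e1, e2, e3, e4]
  have f1 : (ascPochhammer ℝ (2 * (j + 1))).eval z =
      (ascPochhammer ℝ (2 * j)).eval z * (z + 2 * j) * (z + 2 * j + 1) := by
    rw [show 2 * (j + 1) = 2 * j + 1 + 1 by ring, ascPochhammer_succ_eval, ascPochhammer_succ_eval]
    push_cast; ring
  have f2 : (ascPochhammer ℝ (2 * (j + 1))).eval (z - 1) =
      (z - 1) * ((ascPochhammer ℝ (2 * j)).eval z * (z + 2 * j)) := by
    rw [show 2 * (j + 1) = 2 * j + 1 + 1 by ring, ascPochhammer_eval_succ_left,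
      sub_add_cancel, ascPochhammer_succ_eval]
    push_cast; ring
  have f3 : (ascPochhammer ℝ (2 * (j + 1))).eval (z - 2) =
      (z - 2) * ((z - 1) * (ascPochhammer ℝ (2 * j)).eval z) := by
    rw [show 2 * (j + 1) = 2 * j + 1 + 1 by ring, ascPochhammer_eval_succ_left,
      ascPochhammer_eval_succ_left, show z - 2 + 1 = z - 1 by ring, sub_add_cancel]
  have f4 : ((2 * (j + 1)).factorial : ℝ) =
      (2 * j + 2) * (2 * j + 1) * ((2 * j).factorial : ℝ) := by
    rw [show 2 * (j + 1) = 2 * j + 1 + 1 by ring, Nat.factorial_succ, Nat.factorial_succ]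
    push_cast; ring
  rw [f1, f2, f3, f4]
  have h0 : ((2 * j).factorial : ℝ) ≠ 0 := by positivity
  have h1 : (2 * (j : ℝ) + 2) ≠ 0 := by positivity
  have h2 : (2 * (j : ℝ) + 1) ≠ 0 := by positivity
  field_simp
  ring

theorem ascPochhammer_eval_neg_half_sub (j : ℕ) :
    (ascPochhammer ℝ (2 * (j + 1))).eval (-1 / 2 - (j : ℝ)) =
      -(j + 1 / 2) ^ 2 * (ascPochhammer ℝ (2 * j)).eval (1 / 2 - (j : ℝ)) := by
  rw [show 2 * (j + 1) = 2 * j + 1 + 1 by ring, ascPochhammer_eval_succ_left,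
    ascPochhammer_succ_eval, show -1 / 2 - (j : ℝ) + 1 = 1 / 2 - j by ring]
  push_cast; ring

theorem coshKernelCoeff_zero_succ (j : ℕ) :
    coshKernelCoeff 0 (j + 1) = -(2 * j + 1) / (8 * (j + 1)) * coshKernelCoeff 0 j := by
  simp only [coshKernelCoeff]
  have e1 : ((0 : ℕ) : ℝ) - ((j + 1 : ℕ) : ℝ) + 1 / 2 = -1 / 2 - j := by push_cast; ring
  have e2 : ((0 : ℕ) : ℝ) - (j : ℝ) + 1 / 2 = 1 / 2 - j := by push_cast; ring
  rw [e1, e2, ascPochhammer_eval_neg_half_sub]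
  have f4 : ((2 * (j + 1)).factorial : ℝ) =
      (2 * j + 2) * (2 * j + 1) * ((2 * j).factorial : ℝ) := by
    rw [show 2 * (j + 1) = 2 * j + 1 + 1 by ring, Nat.factorial_succ, Nat.factorial_succ]
    push_cast; ring
  rw [f4]
  have h0 : ((2 * j).factorial : ℝ) ≠ 0 := by positivity
  have h1 : (2 * (j : ℝ) + 2) ≠ 0 := by positivity
  have h2 : (2 * (j : ℝ) + 1) ≠ 0 := by positivity
  field_simp
  ring

theorem coshKernelCoeff_one_succ (j : ℕ) :
    coshKernelCoeff 1 (j + 1) = coshKernelCoeff 0 (j + 1) + coshKernelCoeff 0 j / 2 := by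
  rw [coshKernelCoeff_zero_succ]
  simp only [coshKernelCoeff]
  have e1 : ((1 : ℕ) : ℝ) - ((j + 1 : ℕ) : ℝ) + 1 / 2 = 1 / 2 - j := by push_cast; ring
  have e2 : ((0 : ℕ) : ℝ) - (j : ℝ) + 1 / 2 = 1 / 2 - j := by push_cast; ring
  rw [e1, e2, show 2 * (j + 1) = 2 * j + 1 + 1 by ring, ascPochhammer_succ_eval,
    ascPochhammer_succ_eval, Nat.factorial_succ, Nat.factorial_succ]
  have h0 : ((2 * j).factorial : ℝ) ≠ 0 := by positivity
  have h1 : (2 * (j : ℝ) + 2) ≠ 0 := by positivity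
  have h2 : (2 * (j : ℝ) + 1) ≠ 0 := by positivity
  push_cast
  rw [show 2 * (j : ℝ) + 1 + 1 = 2 * j + 2 by ring]
  field_simp
  ring

theorem ringChoose_succ (r : ℝ) (n : ℕ) :
    Ring.choose r (n + 1) = (r - n) / (n + 1) * Ring.choose r n := by
  rw [Ring.choose_eq_smul, Ring.choose_eq_smul, descPochhammer_succ_right,
    Polynomial.smeval_mul, Nat.factorial_succ]
  have : (n.factorial : ℝ) ≠ 0 := by positivity
  simp [Polynomial.smeval_sub, Polynomial.smeval_X, Polynomial.smeval_natCast]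
  field_simp

theorem hasExpansion_one_add_rpow (r : ℝ) :
    HasExpansion (𝓝 0) (fun x => x) (fun x : ℝ => (1 + x) ^ r) (fun n => Ring.choose r n) := by
  intro M
  have h := (Real.one_add_rpow_hasFPowerSeriesAt_zero (a := r)).isBigO_sub_partialSum_pow M
  simp only [zero_add, FormalMultilinearSeries.partialSum, binomialSeries_apply] at h
  refine (h.trans (IsBigO.of_norm_right ?_)).congr_left fun x => ?_
  · simpa using isBigO_refl _ _
  · simp [mul_comm]

theorem isBigO_id_one : (fun x : ℝ => x) =O[𝓝 0] fun _ => (1 : ℝ) :=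
  IsBigO.of_bound 1 <| by
    filter_upwards [Metric.closedBall_mem_nhds (0 : ℝ) one_pos] with x hx
    simpa using hx

/-- Only (k t)^M = O(t^M) is used, so k = 0 is allowed; the unshifted term of the recurrence for
`normρ` relies on this. -/
theorem HasExpansion.scale {ι 𝕜 : Type*} [NormedField 𝕜] {l : Filter ι} {t f : ι → 𝕜} {c : ℕ → 𝕜}
    {k : 𝕜} (h : HasExpansion l (fun x => k * t x) f c) :
    HasExpansion l t f (fun m => c m * k ^ m) := fun M =>
  ((h M).congr_left fun x => by simp only [mul_pow, mul_assoc]).trans <| by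
    simp only [mul_pow]; exact isBigO_const_mul_self _ _ _

theorem hasExpansion_coshKernel_zero :
    HasExpansion (𝓝 0) (fun x => x) (coshKernel 0) (coshKernelCoeff 0) := by
  have ht : Tendsto (fun x : ℝ => (1 / 4 : ℝ) * x) (𝓝 0) (𝓝 0) := by
    have : Continuous fun x : ℝ => (1 / 4 : ℝ) * x := by fun_prop
    simpa using this.tendsto 0
  have h := ((hasExpansion_one_add_rpow (-1 / 2)).comp_tendsto ht).scale
  convert h using 1
  · ext x; rw [coshKernel_zero]; ring_nf
  · ext j
    induction j with
    | zero => simp [coshKernelCoeff_zero_right]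
    | succ j ih =>
      rw [coshKernelCoeff_zero_succ, ih, ringChoose_succ]
      have : (j : ℝ) + 1 ≠ 0 := by positivity
      field_simp
      ring

/-- Induction along the Chebyshev three-term recurrence, starting from the binomial series of (1 +
x/4)^{-1/2}. -/
theorem hasExpansion_coshKernel (ν : ℕ) :
    HasExpansion (𝓝 0) (fun x => x) (coshKernel ν) (coshKernelCoeff ν) := by
  induction ν using Nat.twoStepInduction with
  | zero => exact hasExpansion_coshKernel_zero
  | one =>
    convert hasExpansion_coshKernel_zero.add
      ((hasExpansion_coshKernel_zero.var_mul isBigO_id_one).const_mul (1 / 2)) using 1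
    · ext x; rw [coshKernel_one]; ring
    · ext j
      rcases j with _ | j
      · simp [coshKernelCoeff_zero_right]
      · simp [coshKernelCoeff_one_succ]; ring
  | more ν h0 h1 =>
    convert ((h1.const_mul 2).add (h1.var_mul isBigO_id_one)).sub h0 using 1
    · ext x; rw [coshKernel_add_two]; ring
    · ext j
      rcases j with _ | j
      · simp [coshKernelCoeff_zero_right]; norm_num
      · simp [coshKernelCoeff_add_two]

/-- A crude polynomial growth bound is all that Watson's lemma needs. The induction closes because
(2 + x)(3 + x) + 1 ≤ (3 + x)². -/
theorem abs_coshKernel_le (ν : ℕ) {x : ℝ} (hx : 0 ≤ x) : |coshKernel ν x| ≤ (3 + x) ^ ν := by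
  have h0 : |coshKernel 0 x| ≤ 1 := by
    rw [coshKernel_zero, abs_of_nonneg (by positivity)]
    exact Real.rpow_le_one_of_one_le_of_nonpos (by linarith) (by norm_num)
  induction ν using Nat.twoStepInduction with
  | zero => simpa using h0
  | one =>
    rw [coshKernel_one, abs_mul, abs_of_nonneg (by positivity)]
    nlinarith [abs_nonneg (coshKernel 0 x)]
  | more ν ih0 ih1 =>
    rw [coshKernel_add_two]
    calc _ ≤ |(2 + x) * coshKernel (ν + 1) x| + |coshKernel ν x| := abs_sub _ _
      _ ≤ (2 + x) * (3 + x) ^ (ν + 1) + (3 + x) ^ ν := by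
        rw [abs_mul, abs_of_nonneg (by positivity : 0 ≤ 2 + x)]
        gcongr
      _ ≤ (3 + x) ^ (ν + 2) := by
        have : 0 ≤ (3 + x) ^ ν := by positivity
        rw [pow_succ, pow_add]
        nlinarith

theorem continuousOn_coshKernel (ν : ℕ) : ContinuousOn (coshKernel ν) (Set.Ioi (-4)) := by
  intro x hx
  have hx : -4 < x := hx
  refine ContinuousAt.continuousWithinAt ?_
  refine ContinuousAt.mul ?_ ?_
  · exact ((Polynomial.continuous _).comp (by fun_prop)).continuousAt
  · exact ContinuousAt.rpow_const (by fun_prop) (Or.inl (by linarith))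

theorem measurable_coshKernel (ν : ℕ) : Measurable (coshKernel ν) := by
  refine Measurable.mul ?_ ?_
  · exact ((Polynomial.continuous _).comp (by fun_prop)).measurable
  · fun_prop

/-! ### Gaussian moments and Watson's lemma. -/

/-- The normalized `2j`-th moment of the Gaussian weight `exp (-w ^ 2)`. -/
noncomputable def gaussianMoment (j : ℕ) : ℝ := ((2 * j).factorial : ℝ) / (4 ^ j * (j.factorial : ℝ))

theorem gaussianMoment_nonneg (j : ℕ) : 0 ≤ gaussianMoment j := by
  unfold gaussianMoment; positivity

theorem gaussianMoment_succ (j : ℕ) :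
    gaussianMoment (j + 1) = (j + 1 / 2) * gaussianMoment j := by
  unfold gaussianMoment
  rw [show 2 * (j + 1) = 2 * j + 1 + 1 by ring, Nat.factorial_succ, Nat.factorial_succ,
    Nat.factorial_succ j]
  push_cast
  field_simp
  ring

theorem Gamma_nat_add_half_eq_gaussianMoment (j : ℕ) :
    Real.Gamma (j + 1 / 2) = √Real.pi * gaussianMoment j := by
  induction j with
  | zero => simp [gaussianMoment, ← Real.Gamma_one_half_eq]
  | succ j ih =>
    rw [gaussianMoment_succ, show ((j + 1 : ℕ) : ℝ) + 1 / 2 = (j + 1 / 2 : ℝ) + 1 by push_cast; ring,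
      Real.Gamma_add_one (by positivity), ih]
    ring

theorem integrable_pow_mul_exp_neg_mul_sq {s : ℝ} (hs : 0 < s) (j : ℕ) :
    Integrable fun w : ℝ => Real.exp (-s * w ^ 2) * (w ^ 2) ^ j := by
  have h : (-1 : ℝ) < ((2 * j : ℕ) : ℝ) := lt_of_lt_of_le (by norm_num) (Nat.cast_nonneg _)
  refine (integrable_rpow_mul_exp_neg_mul_sq hs h).congr (Eventually.of_forall fun w => ?_)
  simp only [Real.rpow_natCast]
  rw [pow_mul, mul_comm]

theorem integral_pow_mul_exp_neg_mul_sq {s : ℝ} (hs : 0 < s) (j : ℕ) :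
    ∫ w : ℝ, Real.exp (-s * w ^ 2) * (w ^ 2) ^ j =
      √(Real.pi / s) * (gaussianMoment j * (1 / s) ^ j) := by
  have h : (-1 : ℝ) < ((2 * j : ℕ) : ℝ) := lt_of_lt_of_le (by norm_num) (Nat.cast_nonneg _)
  have h1 := integral_rpow_mul_exp_neg_mul_rpow two_pos h hs
  have h2 := integral_comp_abs (f := fun w : ℝ => Real.exp (-s * w ^ 2) * (w ^ 2) ^ j)
  simp only [sq_abs] at h2
  have h3 : ∫ w in Set.Ioi (0 : ℝ), Real.exp (-s * w ^ 2) * (w ^ 2) ^ j =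
      ∫ w in Set.Ioi (0 : ℝ), w ^ ((2 * j : ℕ) : ℝ) * Real.exp (-s * w ^ (2 : ℝ)) := by
    refine setIntegral_congr_fun measurableSet_Ioi fun w _ => ?_
    simp only [Real.rpow_natCast, Real.rpow_ofNat]
    rw [pow_mul, mul_comm]
  rw [h2, h3, h1, show (((2 * j : ℕ) : ℝ) + 1) / 2 = j + 1 / 2 by push_cast; ring,
    Gamma_nat_add_half_eq_gaussianMoment,
    show -(((2 * j : ℕ) : ℝ) + 1) / 2 = -(j : ℝ) + -(1 / 2) by push_cast; ring,
    Real.rpow_add hs, Real.rpow_neg hs.le, Real.rpow_neg hs.le, ← Real.sqrt_eq_rpow,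
    Real.rpow_natCast, Real.sqrt_div Real.pi_pos.le]
  rw [one_div_pow]
  have : √s ≠ 0 := (Real.sqrt_pos.2 hs).ne'
  field_simp

/-- For x < δ the local expansion gives x^M. For x ≥ δ one has 1 + x ≤ (1/δ + 1) x, so f and its
partial sum, both O((1 + x)^{M+N}), are bounded by a multiple of x^{M+N}. Both powers integrate
against a Gaussian. -/
theorem HasExpansion.exists_global_bound {f : ℝ → ℝ} {γ : ℕ → ℝ}
    (hf : HasExpansion (𝓝[≥] 0) (fun x => x) f γ) {K : ℝ} {N : ℕ}
    (hK : ∀ x, 0 ≤ x → |f x| ≤ K * (1 + x) ^ N) (M : ℕ) :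
    ∃ A : ℝ, 0 ≤ A ∧ ∀ x, 0 ≤ x →
      |f x - ∑ j ∈ range M, γ j * x ^ j| ≤ A * (x ^ M + x ^ (M + N)) := by
  obtain ⟨A₀, hA₀, hb⟩ := (hf M).exists_pos
  rw [isBigOWith_iff, eventually_nhdsWithin_iff, Metric.eventually_nhds_iff] at hb
  obtain ⟨δ, hδ, hb⟩ := hb
  have hK0 : 0 ≤ K := by simpa using (abs_nonneg _).trans (hK 0 le_rfl)
  set S := ∑ j ∈ range M, |γ j| with hS
  have hS0 : 0 ≤ S := sum_nonneg fun _ _ => abs_nonneg _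
  refine ⟨A₀ + (K + S) * (1 / δ + 1) ^ (M + N), by positivity, fun x hx => ?_⟩
  have hP : 0 ≤ (K + S) * (1 / δ + 1) ^ (M + N) := by positivity
  rcases lt_or_ge x δ with h | h
  · have h1 := hb (y := x) (by simpa [abs_of_nonneg hx] using h) hx
    rw [Real.norm_eq_abs, Real.norm_eq_abs, abs_of_nonneg (pow_nonneg hx M)] at h1
    have h2 : 0 ≤ x ^ (M + N) := by positivity
    have h3 : 0 ≤ x ^ M := by positivity
    nlinarith [mul_nonneg hP h2, mul_nonneg hP h3, mul_nonneg hA₀.le h2]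
  · have h1 : (1 : ℝ) ≤ 1 + x := by linarith
    have e1 : |∑ j ∈ range M, γ j * x ^ j| ≤ S * (1 + x) ^ (M + N) := by
      rw [hS, sum_mul]
      refine (abs_sum_le_sum_abs _ _).trans (sum_le_sum fun j hj => ?_)
      rw [abs_mul, abs_of_nonneg (pow_nonneg hx j)]
      gcongr
      calc x ^ j ≤ (1 + x) ^ j := by gcongr; linarith
        _ ≤ _ := pow_le_pow_right₀ h1 (by have := mem_range.1 hj; omega)
    have e2 : |f x| ≤ K * (1 + x) ^ (M + N) :=
      (hK x hx).trans (by gcongr; omega)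
    have e3 : (1 + x) ≤ (1 / δ + 1) * x := by
      have : 1 ≤ 1 / δ * x := by rw [one_div, ← div_eq_inv_mul, le_div_iff₀ hδ]; linarith
      linarith
    calc _ ≤ |f x| + |∑ j ∈ range M, γ j * x ^ j| := abs_sub _ _
      _ ≤ (K + S) * (1 + x) ^ (M + N) := by rw [add_mul]; linarith
      _ ≤ (K + S) * ((1 / δ + 1) * x) ^ (M + N) := by gcongr
      _ = ((K + S) * (1 / δ + 1) ^ (M + N)) * x ^ (M + N) := by rw [mul_pow]; ring
      _ ≤ _ := by
        gcongr
        · linarith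
        · have : 0 ≤ x ^ M := by positivity
          linarith

theorem integrable_exp_neg_mul_sq_mul {f : ℝ → ℝ} (hm : Measurable f) {K : ℝ} {N : ℕ}
    (hK : ∀ x, 0 ≤ x → |f x| ≤ K * (1 + x) ^ N) {s : ℝ} (hs : 0 < s) :
    Integrable fun w : ℝ => Real.exp (-s * w ^ 2) * f (w ^ 2) := by
  have h : Integrable fun w : ℝ => K * ∑ j ∈ range (N + 1),
      (N.choose j : ℝ) * (Real.exp (-s * w ^ 2) * (w ^ 2) ^ j) :=
    (integrable_finsetSum _ fun j _ =>
      (integrable_pow_mul_exp_neg_mul_sq hs j).const_mul _).const_mul _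
  refine h.mono' (by fun_prop) (Eventually.of_forall fun w => ?_)
  rw [norm_mul, Real.norm_eq_abs, Real.norm_eq_abs, abs_of_pos (Real.exp_pos _)]
  calc _ ≤ Real.exp (-s * w ^ 2) * (K * (1 + w ^ 2) ^ N) := by gcongr; exact hK _ (sq_nonneg w)
    _ = _ := by
      rw [add_comm (1 : ℝ), add_pow, mul_left_comm, mul_sum]
      congr 1
      refine sum_congr rfl fun j _ => ?_
      simp; ring

/-- Watson's lemma for Gaussian integrals. -/
theorem HasExpansion.gaussian_integral {f : ℝ → ℝ} {γ : ℕ → ℝ}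
    (hf : HasExpansion (𝓝[≥] 0) (fun x => x) f γ) (hm : Measurable f) {K : ℝ} {N : ℕ}
    (hK : ∀ x, 0 ≤ x → |f x| ≤ K * (1 + x) ^ N) :
    HasExpansion atTop (fun s : ℝ => 1 / s)
      (fun s => √(s / Real.pi) * ∫ w : ℝ, Real.exp (-s * w ^ 2) * f (w ^ 2))
      (fun j => γ j * gaussianMoment j) := by
  intro M
  obtain ⟨A, hA, hb⟩ := hf.exists_global_bound hK M
  refine IsBigO.of_bound (A * (gaussianMoment M + gaussianMoment (M + N))) ?_
  filter_upwards [eventually_ge_atTop 1] with s hs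
  have hs0 : 0 < s := by linarith
  -- The prefactor √(s/π) is the inverse of the total mass of exp(-s w²).
  have hss : √(s / Real.pi) * √(Real.pi / s) = 1 := by
    rw [← Real.sqrt_mul (by positivity)]
    have := Real.pi_pos.ne'
    field_simp
    simp
  have e1 : √(s / Real.pi) * ∫ w : ℝ, Real.exp (-s * w ^ 2) *
      ∑ j ∈ range M, γ j * (w ^ 2) ^ j = ∑ j ∈ range M, γ j * gaussianMoment j * (1 / s) ^ j := by
    have : ∀ w : ℝ, Real.exp (-s * w ^ 2) * ∑ j ∈ range M, γ j * (w ^ 2) ^ j =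
        ∑ j ∈ range M, γ j * (Real.exp (-s * w ^ 2) * (w ^ 2) ^ j) := fun w => by
      rw [mul_sum]; exact sum_congr rfl fun j _ => by ring
    simp only [this]
    rw [integral_finsetSum _ fun j _ => (integrable_pow_mul_exp_neg_mul_sq hs0 j).const_mul _,
      mul_sum]
    refine sum_congr rfl fun j _ => ?_
    rw [integral_const_mul, integral_pow_mul_exp_neg_mul_sq hs0]
    linear_combination γ j * gaussianMoment j * (1 / s) ^ j * hss
  have i1 := integrable_exp_neg_mul_sq_mul hm hK hs0
  have i2 : Integrable fun w : ℝ => Real.exp (-s * w ^ 2) * ∑ j ∈ range M, γ j * (w ^ 2) ^ j := by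
    simp only [mul_sum, mul_left_comm _ (γ _)]
    exact integrable_finsetSum _ fun j _ => (integrable_pow_mul_exp_neg_mul_sq hs0 j).const_mul _
  rw [← e1, ← mul_sub, ← integral_sub i1 i2, norm_mul, Real.norm_of_nonneg (Real.sqrt_nonneg _)]
  have hbound : ‖∫ w : ℝ, (Real.exp (-s * w ^ 2) * f (w ^ 2) -
      Real.exp (-s * w ^ 2) * ∑ j ∈ range M, γ j * (w ^ 2) ^ j)‖ ≤
      ∫ w : ℝ, A * (Real.exp (-s * w ^ 2) * (w ^ 2) ^ M +
        Real.exp (-s * w ^ 2) * (w ^ 2) ^ (M + N)) := by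
    refine norm_integral_le_of_norm_le (((integrable_pow_mul_exp_neg_mul_sq hs0 _).add
      (integrable_pow_mul_exp_neg_mul_sq hs0 _)).const_mul _) (Eventually.of_forall fun w => ?_)
    rw [← mul_sub, norm_mul, Real.norm_of_nonneg (Real.exp_pos _).le, Real.norm_eq_abs]
    calc _ ≤ Real.exp (-s * w ^ 2) * (A * ((w ^ 2) ^ M + (w ^ 2) ^ (M + N))) := by
          gcongr; exact hb _ (sq_nonneg w)
      _ = _ := by ring
  rw [integral_const_mul, integral_add (integrable_pow_mul_exp_neg_mul_sq hs0 _)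
    (integrable_pow_mul_exp_neg_mul_sq hs0 _), integral_pow_mul_exp_neg_mul_sq hs0,
    integral_pow_mul_exp_neg_mul_sq hs0] at hbound
  have hpow : (1 / s) ^ (M + N) ≤ (1 / s) ^ M :=
    pow_le_pow_of_le_one (by positivity) (by rw [div_le_one hs0]; exact hs) (by omega)
  calc _ ≤ √(s / Real.pi) * (A * (√(Real.pi / s) * (gaussianMoment M * (1 / s) ^ M) +
        √(Real.pi / s) * (gaussianMoment (M + N) * (1 / s) ^ (M + N)))) := by gcongr
    _ = A * (gaussianMoment M * (1 / s) ^ M + gaussianMoment (M + N) * (1 / s) ^ (M + N)) := by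
        linear_combination A * (gaussianMoment M * (1 / s) ^ M +
          gaussianMoment (M + N) * (1 / s) ^ (M + N)) * hss
    _ ≤ A * (gaussianMoment M * (1 / s) ^ M + gaussianMoment (M + N) * (1 / s) ^ M) := by
        gcongr; exact gaussianMoment_nonneg _
    _ = _ := by rw [Real.norm_of_nonneg (by positivity)]; ring

/-! ### Large-argument expansion of K_ν(2s). -/

/-- For w = 2 sinh(u/2) one has dw = cosh(u/2) du and w² = 2 cosh u - 2, so this identity turns
cosh(νu) du into the kernel times dw. -/
theorem coshKernel_two_sinh_sq (ν : ℕ) (u : ℝ) :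
    Real.cosh (u / 2) * coshKernel ν ((2 * Real.sinh (u / 2)) ^ 2) = Real.cosh (ν * u) := by
  have hc : Real.cosh u = 2 * Real.sinh (u / 2) ^ 2 + 1 := by
    have := Real.cosh_two_mul (u / 2)
    rw [Real.cosh_sq, mul_div_cancel₀ u two_ne_zero] at this
    linarith
  have hp := Real.cosh_pos (u / 2)
  rw [coshKernel, show 1 + (2 * Real.sinh (u / 2)) ^ 2 / 2 = Real.cosh u by rw [hc]; ring,
    show 1 + (2 * Real.sinh (u / 2)) ^ 2 / 4 = Real.cosh (u / 2) ^ 2 by rw [Real.cosh_sq]; ring,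
    Polynomial.Chebyshev.T_real_cosh, ← Real.rpow_natCast (Real.cosh (u / 2)),
    ← Real.rpow_mul hp.le, show ((2 : ℕ) : ℝ) * (-1 / 2) = -1 by norm_num, Real.rpow_neg_one,
    mul_left_comm, mul_inv_cancel₀ hp.ne', mul_one, Int.cast_natCast]

theorem image_two_sinh_half : (fun u : ℝ => 2 * Real.sinh (u / 2)) '' Set.univ = Set.univ := by
  rw [Set.image_univ, Set.range_eq_univ]
  intro y
  obtain ⟨v, hv⟩ := Real.sinh_surjective (y / 2)
  refine ⟨2 * v, ?_⟩
  simp only [mul_div_cancel_left₀ v (two_ne_zero (α := ℝ)), hv]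
  ring

theorem hasDerivAt_two_sinh_half (u : ℝ) :
    HasDerivAt (fun u : ℝ => 2 * Real.sinh (u / 2)) (Real.cosh (u / 2)) u :=
  (((hasDerivAt_id' u).div_const 2).sinh.const_mul 2).congr_deriv (by ring)

theorem injective_two_sinh_half : Function.Injective (fun u : ℝ => 2 * Real.sinh (u / 2)) := by
  intro u v h
  have : u / 2 = v / 2 := Real.sinh_injective (by simpa using h)
  linarith

theorem two_sinh_half_sq (u : ℝ) : (2 * Real.sinh (u / 2)) ^ 2 = 2 * Real.cosh u - 2 := by
  have := Real.cosh_two_mul (u / 2)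
  rw [Real.cosh_sq, mul_div_cancel₀ u two_ne_zero] at this
  linarith

theorem coshKernel_bound (ν : ℕ) (x : ℝ) (hx : 0 ≤ x) :
    |coshKernel ν x| ≤ 3 ^ ν * (1 + x) ^ ν := by
  refine (abs_coshKernel_le ν hx).trans ?_
  rw [← mul_pow]
  gcongr
  linarith

theorem cosh_half_mul_exp_mul_coshKernel (ν : ℕ) (s u : ℝ) :
    |Real.cosh (u / 2)| • (Real.exp (-s * (2 * Real.sinh (u / 2)) ^ 2) *
      coshKernel ν ((2 * Real.sinh (u / 2)) ^ 2)) =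
    Real.exp (2 * s) * (Real.cosh (ν * u) * Real.exp (-(2 * s * Real.cosh u))) := by
  rw [abs_of_pos (Real.cosh_pos _), smul_eq_mul, mul_left_comm, coshKernel_two_sinh_sq,
    two_sinh_half_sq, mul_left_comm, mul_comm (Real.exp _), ← Real.exp_add]
  ring_nf

theorem integrable_cosh_mul_exp_neg_cosh (ν : ℕ) {s : ℝ} (hs : 0 < s) :
    Integrable fun u : ℝ => Real.cosh (ν * u) * Real.exp (-(2 * s * Real.cosh u)) := by
  have h := integrableOn_image_iff_integrableOn_abs_deriv_smul MeasurableSet.univ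
    (fun u _ => (hasDerivAt_two_sinh_half u).hasDerivWithinAt) injective_two_sinh_half.injOn
    (fun w : ℝ => Real.exp (-s * w ^ 2) * coshKernel ν (w ^ 2))
  rw [image_two_sinh_half, integrableOn_univ, integrableOn_univ] at h
  have h2 := h.1 (integrable_exp_neg_mul_sq_mul (measurable_coshKernel ν) (coshKernel_bound ν) hs)
  simp only [cosh_half_mul_exp_mul_coshKernel] at h2
  exact (integrable_const_mul_iff (Real.exp_ne_zero (2 * s)).isUnit _).1 h2

theorem integral_cosh_mul_exp_neg_cosh (ν : ℕ) (s : ℝ) :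
    ∫ u : ℝ, Real.cosh (ν * u) * Real.exp (-(2 * s * Real.cosh u)) =
      Real.exp (-(2 * s)) * ∫ w : ℝ, Real.exp (-s * w ^ 2) * coshKernel ν (w ^ 2) := by
  have h := integral_image_eq_integral_abs_deriv_smul MeasurableSet.univ
    (fun u _ => (hasDerivAt_two_sinh_half u).hasDerivWithinAt) injective_two_sinh_half.injOn
    (fun w : ℝ => Real.exp (-s * w ^ 2) * coshKernel ν (w ^ 2))
  rw [image_two_sinh_half, setIntegral_univ, setIntegral_univ] at h
  simp only [cosh_half_mul_exp_mul_coshKernel] at h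
  rw [h, integral_const_mul, ← mul_assoc, ← Real.exp_add]
  simp

theorem integrable_exp_mul_exp_neg_cosh (ν : ℕ) {s : ℝ} (hs : 0 < s) :
    Integrable fun u : ℝ => Real.exp (ν * u) * Real.exp (-(2 * s * Real.cosh u)) := by
  refine ((integrable_cosh_mul_exp_neg_cosh ν hs).const_mul 2).mono' (by fun_prop)
    (Eventually.of_forall fun u => ?_)
  rw [Real.norm_of_nonneg (by positivity), ← mul_assoc]
  gcongr
  rw [Real.cosh_eq]
  have := Real.exp_pos (-(ν * u))
  linarith

/-- Average over u ↦ -u, under which the weight is invariant. -/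
theorem integral_exp_mul_exp_neg_cosh (ν : ℕ) {s : ℝ} (hs : 0 < s) :
    ∫ u : ℝ, Real.exp (ν * u) * Real.exp (-(2 * s * Real.cosh u)) =
      ∫ u : ℝ, Real.cosh (ν * u) * Real.exp (-(2 * s * Real.cosh u)) := by
  have i1 := integrable_exp_mul_exp_neg_cosh ν hs
  have h1 := integral_neg_eq_self
    (fun u : ℝ => Real.exp (ν * u) * Real.exp (-(2 * s * Real.cosh u))) volume
  have i2 := i1.comp_neg
  have h2 : ∫ u : ℝ, Real.cosh (ν * u) * Real.exp (-(2 * s * Real.cosh u)) =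
      ∫ u : ℝ, (1 / 2 : ℝ) * (Real.exp (ν * u) * Real.exp (-(2 * s * Real.cosh u)) +
        Real.exp (ν * -u) * Real.exp (-(2 * s * Real.cosh (-u)))) := by
    congr 1 with u
    rw [Real.cosh_neg, Real.cosh_eq (ν * u), mul_neg]
    ring
  rw [h2, integral_const_mul, integral_add i1 i2, h1]
  ring

theorem image_exp_div {s : ℝ} (hs : 0 < s) :
    (fun u : ℝ => Real.exp u / s) '' Set.univ = Set.Ioi 0 := by
  ext y
  simp only [Set.image_univ, Set.mem_range, Set.mem_Ioi]
  constructor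
  · rintro ⟨u, rfl⟩; positivity
  · intro hy
    exact ⟨Real.log (y * s), by rw [Real.exp_log (by positivity)]; field_simp⟩

/-- The substitution h = e^u / s balances s²h against 1/h, giving 2s cosh u; its Jacobian raises the
index from i to i + 1. -/
theorem exp_div_mul_besselIntegrand (i : ℕ) {s : ℝ} (hs : 0 < s) (u : ℝ) :
    |Real.exp u / s| • ((Real.exp u / s) ^ i *
      Real.exp (-(s ^ 2 * (Real.exp u / s)) - 1 / (Real.exp u / s))) =
    (1 / s) ^ (i + 1) * (Real.exp ((i + 1 : ℕ) * u) * Real.exp (-(2 * s * Real.cosh u))) := by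
  rw [abs_of_pos (by positivity), smul_eq_mul, ← mul_assoc, ← pow_succ', Real.exp_nat_mul,
    div_eq_mul_one_div (Real.exp u) s, mul_pow, Real.cosh_eq, Real.exp_neg u]
  have : -(s ^ 2 * (Real.exp u * (1 / s))) - 1 / (Real.exp u * (1 / s)) =
      -(2 * s * ((Real.exp u + (Real.exp u)⁻¹) / 2)) := by
    field_simp
    ring
  rw [this]
  ring

theorem integrableOn_besselIntegrand (i : ℕ) {s : ℝ} (hs : 0 < s) :
    IntegrableOn (fun h : ℝ => h ^ i * Real.exp (-(s ^ 2 * h) - 1 / h)) (Set.Ioi 0) := by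
  have h := integrableOn_image_iff_integrableOn_abs_deriv_smul MeasurableSet.univ
    (fun u _ => ((Real.hasDerivAt_exp u).div_const s).hasDerivWithinAt)
    (fun u _ v _ huv => Real.exp_injective (by
      simpa [div_left_inj' hs.ne'] using huv))
    (fun h : ℝ => h ^ i * Real.exp (-(s ^ 2 * h) - 1 / h))
  rw [image_exp_div hs, integrableOn_univ] at h
  simp only [exp_div_mul_besselIntegrand i hs] at h
  exact h.2 ((integrable_exp_mul_exp_neg_cosh (i + 1) hs).const_mul _)

theorem integral_besselIntegrand (i : ℕ) {s : ℝ} (hs : 0 < s) :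
    ∫ h in Set.Ioi (0 : ℝ), h ^ i * Real.exp (-(s ^ 2 * h) - 1 / h) =
      (1 / s) ^ (i + 1) * (Real.exp (-(2 * s)) *
        ∫ w : ℝ, Real.exp (-s * w ^ 2) * coshKernel (i + 1) (w ^ 2)) := by
  have h := integral_image_eq_integral_abs_deriv_smul MeasurableSet.univ
    (fun u _ => ((Real.hasDerivAt_exp u).div_const s).hasDerivWithinAt)
    (fun u _ v _ huv => Real.exp_injective (by
      simpa [div_left_inj' hs.ne'] using huv))
    (fun h : ℝ => h ^ i * Real.exp (-(s ^ 2 * h) - 1 / h))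
  rw [image_exp_div hs, setIntegral_univ] at h
  simp only [exp_div_mul_besselIntegrand i hs] at h
  rw [h, integral_const_mul, integral_exp_mul_exp_neg_cosh _ hs, integral_cosh_mul_exp_neg_cosh]

/-- The asymptotic expansion of `K_{i+1}(2s)` for large `s`. -/
theorem hasExpansion_besselK (i : ℕ) :
    HasExpansion atTop (fun s : ℝ => 1 / s)
      (fun s => √(s / Real.pi) * Real.exp (2 * s) * s ^ (i + 1) *
        ∫ h in Set.Ioi (0 : ℝ), h ^ i * Real.exp (-(s ^ 2 * h) - 1 / h))
      (fun j => coshKernelCoeff (i + 1) j * gaussianMoment j) := by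
  refine (((hasExpansion_coshKernel (i + 1)).mono nhdsWithin_le_nhds).gaussian_integral
    (measurable_coshKernel _) (coshKernel_bound _)).congr' ?_
  filter_upwards [eventually_gt_atTop 0] with s hs
  rw [integral_besselIntegrand i hs]
  have : Real.exp (2 * s) * Real.exp (-(2 * s)) = 1 := by rw [← Real.exp_add]; simp
  have h2 : s ^ (i + 1) * (1 / s) ^ (i + 1) = 1 := by
    rw [← mul_pow, mul_one_div_cancel hs.ne', one_pow]
  set J := ∫ w : ℝ, Real.exp (-s * w ^ 2) * coshKernel (i + 1) (w ^ 2)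
  linear_combination -(√(s / Real.pi) * J * (Real.exp (2 * s) * Real.exp (-(2 * s)))) * h2 -
    √(s / Real.pi) * J * this

/-! ### Large-argument expansion of I_ν(2s). -/

/-- The function `cos (ν φ) / cos (φ / 2)` in the variable `x = (2 sin (φ / 2)) ^ 2`,
cut off at `x = 2`. -/
noncomputable def cosKernel (ν : ℕ) (x : ℝ) : ℝ :=
  if x ≤ 2 then coshKernel ν (-x) else 0

theorem measurable_cosKernel (ν : ℕ) : Measurable (cosKernel ν) :=
  Measurable.ite measurableSet_Iic ((measurable_coshKernel ν).comp measurable_neg) measurable_const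

/-- The cut-off keeps the argument of `coshKernel` in [-2, 0], away from the singularity of (1 +
x/4)^{-1/2} at -4, so compactness gives a bound. -/
theorem exists_abs_cosKernel_le (ν : ℕ) :
    ∃ K : ℝ, ∀ x, 0 ≤ x → |cosKernel ν x| ≤ K * (1 + x) ^ 0 := by
  have hc : ContinuousOn (fun x => coshKernel ν (-x)) (Set.Icc 0 2) :=
    (continuousOn_coshKernel ν).comp continuousOn_neg fun x hx => by
      have := hx.2
      show (-4 : ℝ) < -x
      linarith
  obtain ⟨K, hK⟩ := isCompact_Icc.exists_bound_of_continuousOn hc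
  refine ⟨K, fun x hx => ?_⟩
  rw [pow_zero, mul_one, cosKernel]
  split_ifs with h
  · exact hK x ⟨hx, h⟩
  · rw [abs_zero]
    exact (norm_nonneg _).trans (hK 0 (by simp))

theorem hasExpansion_cosKernel (ν : ℕ) :
    HasExpansion (𝓝 0) (fun x => x) (cosKernel ν) (fun j => coshKernelCoeff ν j * (-1) ^ j) := by
  have ht : Tendsto (fun x : ℝ => (-1 : ℝ) * x) (𝓝 0) (𝓝 0) := by
    have : Continuous fun x : ℝ => (-1 : ℝ) * x := by fun_prop
    simpa using this.tendsto 0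
  refine ((hasExpansion_coshKernel ν).comp_tendsto ht).scale.congr' ?_
  filter_upwards [Iic_mem_nhds (show (0 : ℝ) < 2 by norm_num)] with x hx
  rw [cosKernel, if_pos (Set.mem_Iic.1 hx), neg_one_mul]

theorem two_sin_half_sq (φ : ℝ) : (2 * Real.sin (φ / 2)) ^ 2 = 2 - 2 * Real.cos φ := by
  have := Real.cos_two_mul (φ / 2)
  rw [Real.cos_sq', mul_div_cancel₀ φ two_ne_zero] at this
  linarith

theorem cos_half_mul_coshKernel (ν : ℕ) {φ : ℝ} (hφ : 0 < Real.cos (φ / 2)) :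
    coshKernel ν (-(2 * Real.sin (φ / 2)) ^ 2) * Real.cos (φ / 2) = Real.cos (ν * φ) := by
  have h := two_sin_half_sq φ
  rw [coshKernel, show 1 + -(2 * Real.sin (φ / 2)) ^ 2 / 2 = Real.cos φ by rw [h]; ring,
    show 1 + -(2 * Real.sin (φ / 2)) ^ 2 / 4 = Real.cos (φ / 2) ^ 2 by rw [Real.cos_sq']; ring,
    Polynomial.Chebyshev.T_real_cos, ← Real.rpow_natCast (Real.cos (φ / 2)),
    ← Real.rpow_mul hφ.le, show ((2 : ℕ) : ℝ) * (-1 / 2) = -1 by norm_num, Real.rpow_neg_one,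
    mul_assoc, inv_mul_cancel₀ hφ.ne', mul_one, Int.cast_natCast]

theorem cos_half_pos {φ : ℝ} (hφ : φ ∈ Set.Icc (-(Real.pi / 2)) (Real.pi / 2)) :
    0 < Real.cos (φ / 2) := by
  have := Real.pi_pos
  exact Real.cos_pos_of_mem_Ioo ⟨by linarith [hφ.1], by linarith [hφ.2]⟩

/-- The substitution w = 2 sin(φ/2) maps [-π/2, π/2] onto w² ≤ 2, which is exactly where `cosKernel`
is not cut off. -/
theorem integral_exp_cos_eq_gaussian (ν : ℕ) (s : ℝ) :
    ∫ φ in (-(Real.pi / 2))..(Real.pi / 2), Real.cos (ν * φ) * Real.exp (2 * s * Real.cos φ) =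
      Real.exp (2 * s) * ∫ w : ℝ, Real.exp (-s * w ^ 2) * cosKernel ν (w ^ 2) := by
  have hpi := Real.pi_pos
  have hle : -(Real.pi / 2) ≤ Real.pi / 2 := by linarith
  have hsub := intervalIntegral.integral_comp_mul_deriv'' (a := -(Real.pi / 2)) (b := Real.pi / 2)
    (f := fun φ : ℝ => 2 * Real.sin (φ / 2)) (f' := fun φ => Real.cos (φ / 2))
    (g := fun w => Real.exp (-s * w ^ 2) * coshKernel ν (-w ^ 2))
    (by fun_prop)
    (fun φ _ => by
      refine HasDerivAt.hasDerivWithinAt ?_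
      exact (((hasDerivAt_id' φ).div_const 2).sin.const_mul 2).congr_deriv (by ring))
    (by fun_prop)
    (by
      refine ContinuousOn.mul (by fun_prop) ?_
      refine (continuousOn_coshKernel ν).comp (by fun_prop) ?_
      rintro _ ⟨φ, hφ, rfl⟩
      rw [Set.uIcc_of_le hle] at hφ
      have h1 := Real.cos_nonneg_of_mem_Icc hφ
      have h2 := two_sin_half_sq φ
      show (-4 : ℝ) < -(2 * Real.sin (φ / 2)) ^ 2
      linarith)
  have e1 : ∫ φ in (-(Real.pi / 2))..(Real.pi / 2), Real.cos (ν * φ) * Real.exp (2 * s * Real.cos φ)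
      = Real.exp (2 * s) * ∫ φ in (-(Real.pi / 2))..(Real.pi / 2),
        ((fun w => Real.exp (-s * w ^ 2) * coshKernel ν (-w ^ 2)) ∘
          fun φ : ℝ => 2 * Real.sin (φ / 2)) φ * Real.cos (φ / 2) := by
    rw [← intervalIntegral.integral_const_mul]
    refine intervalIntegral.integral_congr fun φ hφ => ?_
    rw [Set.uIcc_of_le hle] at hφ
    simp only [Function.comp_apply]
    rw [mul_assoc (Real.exp _), cos_half_mul_coshKernel ν (cos_half_pos hφ), two_sin_half_sq,
      ← mul_assoc, ← Real.exp_add, mul_comm]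
    ring_nf
  have e2 : ∫ w : ℝ, Real.exp (-s * w ^ 2) * cosKernel ν (w ^ 2) =
      ∫ w in (-√2)..√2, Real.exp (-s * w ^ 2) * coshKernel ν (-w ^ 2) := by
    have h2 : (0 : ℝ) ≤ √2 := Real.sqrt_nonneg 2
    rw [intervalIntegral.integral_of_le (by linarith), ← integral_Icc_eq_integral_Ioc,
      ← integral_indicator measurableSet_Icc]
    congr 1 with w
    have hw : w ∈ Set.Icc (-√2) √2 ↔ w ^ 2 ≤ 2 := by
      rw [Set.mem_Icc, ← abs_le, Real.le_sqrt (abs_nonneg w) zero_le_two, sq_abs]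
    by_cases h : w ^ 2 ≤ 2
    · rw [Set.indicator_of_mem (hw.2 h), cosKernel, if_pos h]
    · rw [Set.indicator_of_notMem (fun h' => h (hw.1 h')), cosKernel, if_neg h, mul_zero]
  rw [e1, hsub, e2]
  have hs1 : 2 * Real.sin (Real.pi / 2 / 2) = √2 := by
    rw [show Real.pi / 2 / 2 = Real.pi / 4 by ring, Real.sin_pi_div_four]; ring
  have hs2 : 2 * Real.sin (-(Real.pi / 2) / 2) = -√2 := by
    rw [neg_div, Real.sin_neg, mul_neg, hs1]
  rw [hs1, hs2]

theorem hasExpansion_besselI_main (ν : ℕ) :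
    HasExpansion atTop (fun s : ℝ => 1 / s)
      (fun s => √(s / Real.pi) * Real.exp (-(2 * s)) *
        ∫ φ in (-(Real.pi / 2))..(Real.pi / 2), Real.cos (ν * φ) * Real.exp (2 * s * Real.cos φ))
      (fun j => coshKernelCoeff ν j * (-1) ^ j * gaussianMoment j) := by
  obtain ⟨K, hK⟩ := exists_abs_cosKernel_le ν
  refine (((hasExpansion_cosKernel ν).mono nhdsWithin_le_nhds).gaussian_integral
    (measurable_cosKernel _) hK).congr' (Eventually.of_forall fun s => ?_)
  simp only
  rw [integral_exp_cos_eq_gaussian, mul_assoc, ← mul_assoc (Real.exp _), ← Real.exp_add]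
  simp

/-- Here cos φ ≤ 0, so the integrand is at most 1 in absolute value on an interval of length π.
Against the normalization e^{-2s} this part is negligible. -/
theorem abs_integral_exp_cos_far_le (ν : ℕ) {s : ℝ} (hs : 0 ≤ s) :
    |∫ φ in (Real.pi / 2)..(3 * Real.pi / 2), Real.cos (ν * φ) * Real.exp (2 * s * Real.cos φ)| ≤
      Real.pi := by
  have hpi := Real.pi_pos
  have h := intervalIntegral.norm_integral_le_of_norm_le_const (a := Real.pi / 2)
    (b := 3 * Real.pi / 2) (C := 1)
    (f := fun φ => Real.cos (ν * φ) * Real.exp (2 * s * Real.cos φ)) (fun φ hφ => by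
      rw [Set.uIoc_of_le (by linarith)] at hφ
      have hc : Real.cos φ ≤ 0 :=
        Real.cos_nonpos_of_pi_div_two_le_of_le hφ.1.le (by linarith [hφ.2])
      rw [norm_mul, Real.norm_eq_abs, Real.norm_of_nonneg (Real.exp_pos _).le]
      have h1 : Real.exp (2 * s * Real.cos φ) ≤ 1 := by
        rw [Real.exp_le_one_iff]; nlinarith
      exact mul_le_one₀ (Real.abs_cos_le_one _) (Real.exp_pos _).le h1)
  rw [show 3 * Real.pi / 2 - Real.pi / 2 = Real.pi by ring, abs_of_pos hpi, one_mul] at h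
  exact h

theorem isBigO_sqrt_mul_exp_neg (M : ℕ) :
    (fun s : ℝ => √(s / Real.pi) * Real.exp (-(2 * s))) =O[atTop] fun s => (1 / s) ^ M := by
  refine IsBigO.trans (g := fun s => Real.exp (-s)) ?_ ?_
  · refine IsBigO.of_bound 1 ?_
    filter_upwards [eventually_ge_atTop 1] with s hs
    rw [norm_mul, Real.norm_of_nonneg (Real.sqrt_nonneg _), Real.norm_of_nonneg (Real.exp_pos _).le,
      Real.norm_of_nonneg (Real.exp_pos _).le, one_mul,
      show -(2 * s) = -s + -s by ring, Real.exp_add, ← mul_assoc]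
    refine mul_le_of_le_one_left (Real.exp_pos _).le ?_
    rw [Real.exp_neg, ← div_eq_mul_inv, div_le_one (Real.exp_pos _)]
    have h1 : √(s / Real.pi) ≤ s := by
      rw [Real.sqrt_le_left (by linarith)]
      have : s / Real.pi ≤ s := div_le_self (by linarith) (by linarith [Real.pi_gt_three])
      nlinarith
    linarith [Real.add_one_le_exp s]
  · have := (Real.isLittleO_pow_exp_atTop (n := M)).isBigO.inv_rev
      (by filter_upwards [eventually_gt_atTop 0] with s hs h0; exact absurd h0 (by positivity))
    simpa [Real.exp_neg] using this

/-- The asymptotic expansion of `I_ν(2s)` for large `s`. -/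
theorem hasExpansion_besselI (ν : ℕ) :
    HasExpansion atTop (fun s : ℝ => 1 / s)
      (fun s => √(s / Real.pi) * Real.exp (-(2 * s)) *
        ∫ φ in (0 : ℝ)..(2 * Real.pi), Real.cos (ν * φ) * Real.exp (2 * s * Real.cos φ))
      (fun j => coshKernelCoeff ν j * (-1) ^ j * gaussianMoment j) := by
  intro M
  have hfar : (fun s : ℝ => √(s / Real.pi) * Real.exp (-(2 * s)) *
      ∫ φ in (Real.pi / 2)..(3 * Real.pi / 2), Real.cos (ν * φ) * Real.exp (2 * s * Real.cos φ))
      =O[atTop] fun s => (1 / s) ^ M := by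
    have : (fun s : ℝ => ∫ φ in (Real.pi / 2)..(3 * Real.pi / 2),
        Real.cos (ν * φ) * Real.exp (2 * s * Real.cos φ)) =O[atTop] fun _ => (1 : ℝ) := by
      refine IsBigO.of_bound Real.pi ?_
      filter_upwards [eventually_ge_atTop 0] with s hs
      simpa using abs_integral_exp_cos_far_le ν hs
    simpa using (isBigO_sqrt_mul_exp_neg M).mul this
  refine ((hasExpansion_besselI_main ν M).add hfar).congr_left fun s => ?_
  -- Periodicity moves the window to [-π/2, 3π/2], which splits into the neighbourhood of the
  -- maximum φ = 0 and the negligible half.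
  have hper : Function.Periodic (fun φ => Real.cos (ν * φ) * Real.exp (2 * s * Real.cos φ))
      (2 * Real.pi) := fun φ => by
    simp only
    rw [Real.cos_add_two_pi, mul_add, Real.cos_add_nat_mul_two_pi]
  have h1 := hper.intervalIntegral_add_eq 0 (-(Real.pi / 2))
  have hc : Continuous fun φ => Real.cos (ν * φ) * Real.exp (2 * s * Real.cos φ) := by fun_prop
  have h2 := intervalIntegral.integral_add_adjacent_intervals
    (μ := volume) (hc.intervalIntegrable (-(Real.pi / 2)) (Real.pi / 2))
    (hc.intervalIntegrable (Real.pi / 2) (3 * Real.pi / 2))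
  rw [zero_add, show -(Real.pi / 2) + 2 * Real.pi = 3 * Real.pi / 2 by ring, ← h2] at h1
  simp only
  rw [h1]
  ring

/-! ### The function μ: removable singularity, oddness, bounds. -/

namespace BGG

/-- The complex version of `μ`. -/
noncomputable def μC (h : ℂ) : ℂ :=
  if h = 0 then 0 else 1 / h - 1 / (Complex.exp h - 1) - 1 / 2

/-- Otherwise |h| = |e^h - 1 - h| ≤ |h|² < |h|. -/
theorem exp_sub_one_ne_zero {h : ℂ} (h0 : h ≠ 0) (h1 : ‖h‖ < 1) : Complex.exp h - 1 ≠ 0 := by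
  intro he
  have h2 := Complex.norm_exp_sub_one_sub_id_le h1.le
  rw [he, zero_sub, norm_neg] at h2
  have h3 := norm_pos_iff.2 h0
  nlinarith

theorem μC_ofReal (x : ℝ) : μC x = (μ x : ℂ) := by
  unfold μC μ
  split_ifs with h1 h2 h2
  · simp
  · exact absurd (by exact_mod_cast h1) h2
  · exact absurd (by exact_mod_cast h2) h1
  · push_cast; rfl

theorem μC_neg {h : ℂ} (h1 : ‖h‖ < 1) : μC (-h) = -μC h := by
  by_cases h0 : h = 0
  · simp [μC, h0]
  have he := exp_sub_one_ne_zero h0 h1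
  rw [μC, μC, if_neg h0, if_neg (neg_ne_zero.2 h0), Complex.exp_neg]
  have h2 := Complex.exp_ne_zero h
  have h3 : 1 - Complex.exp h ≠ 0 := by rw [← neg_sub]; exact neg_ne_zero.2 he
  have h4 : (Complex.exp h)⁻¹ - 1 = (1 - Complex.exp h) / Complex.exp h := by field_simp
  rw [h4, ← neg_sub (Complex.exp h) 1]
  field_simp
  ring

/-- With E = e^h - 1 - h - h²/2 = O(h³), the numerator of μ over 2h(e^h - 1) is O(h³) while the
denominator has size at least |h|²/2 · 2. This bound gives the continuity at 0 needed to remove the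
singularity. -/
theorem norm_μC_le {h : ℂ} (h1 : ‖h‖ ≤ 1 / 2) : ‖μC h‖ ≤ 3 * ‖h‖ := by
  by_cases h0 : h = 0
  · simp [μC, h0]
  have he := exp_sub_one_ne_zero h0 (by linarith)
  have hn := norm_pos_iff.2 h0
  set E := Complex.exp h - 1 - h - h ^ 2 / 2 with hE
  have hEb : ‖E‖ ≤ ‖h‖ ^ 3 := by
    have := Complex.exp_bound (x := h) (by linarith) (n := 3) (by norm_num)
    simp only [sum_range_succ, sum_range_zero, zero_add] at this
    have e : Complex.exp h - (h ^ 0 / (Nat.factorial 0 : ℂ) + h ^ 1 / (Nat.factorial 1 : ℂ) +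
        h ^ 2 / (Nat.factorial 2 : ℂ)) = E := by
      rw [hE]; norm_num [Nat.factorial]; ring
    rw [e] at this
    refine this.trans ?_
    norm_num [Nat.factorial]
    nlinarith [pow_pos hn 3]
  have hden : ‖h‖ / 2 ≤ ‖Complex.exp h - 1‖ := by
    have h2 := Complex.norm_exp_sub_one_sub_id_le (x := h) (by linarith)
    have h3 := norm_sub_norm_le h (h - (Complex.exp h - 1))
    rw [sub_sub_cancel, norm_sub_rev h] at h3
    nlinarith
  have hform : μC h = (2 * E - h ^ 3 / 2 - h * E) / (2 * h * (Complex.exp h - 1)) := by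
    rw [μC, if_neg h0, hE]
    field_simp
    ring
  have hnum : ‖2 * E - h ^ 3 / 2 - h * E‖ ≤ 3 * ‖h‖ ^ 3 := by
    have h2 : ‖2 * E - h ^ 3 / 2 - h * E‖ ≤ 2 * ‖E‖ + ‖h‖ ^ 3 / 2 + ‖h‖ * ‖E‖ := by
      refine (norm_sub_le _ _).trans (add_le_add ((norm_sub_le _ _).trans ?_) (norm_mul_le _ _))
      simp
    nlinarith [norm_nonneg E, pow_pos hn 3]
  rw [hform, norm_div, div_le_iff₀ (norm_pos_iff.2 (mul_ne_zero (mul_ne_zero two_ne_zero h0) he)), norm_mul, norm_mul, Complex.norm_ofNat]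
  have : ‖h‖ * (‖h‖ / 2) ≤ ‖h‖ * ‖Complex.exp h - 1‖ := by gcongr
  nlinarith

theorem analyticAt_μC : AnalyticAt ℂ μC 0 := by
  refine Complex.analyticAt_of_differentiable_on_punctured_nhds_of_continuousAt ?_ ?_
  · rw [eventually_nhdsWithin_iff]
    filter_upwards [Metric.ball_mem_nhds (0 : ℂ) one_pos] with z hz hz0
    have hz1 : ‖z‖ < 1 := by simpa using hz
    have he := exp_sub_one_ne_zero hz0 hz1
    have hd : DifferentiableAt ℂ (fun h : ℂ => 1 / h - 1 / (Complex.exp h - 1) - 1 / 2) z := by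
      have : z ≠ 0 := hz0
      fun_prop (disch := assumption)
    refine hd.congr_of_eventuallyEq ?_
    filter_upwards [isOpen_ne.mem_nhds hz0] with w hw
    rw [μC, if_neg hw]
  · have h0 : μC 0 = 0 := by simp [μC]
    rw [ContinuousAt, h0]
    refine squeeze_zero_norm' (a := fun h : ℂ => 3 * ‖h‖) ?_ ?_
    · filter_upwards [Metric.closedBall_mem_nhds (0 : ℂ) (show (0 : ℝ) < 1 / 2 by norm_num)]
        with h hh
      exact norm_μC_le (by simpa using hh)
    · have : Continuous fun h : ℂ => 3 * ‖h‖ := by fun_prop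
      simpa using this.tendsto 0

theorem analyticAt_exp_μ : AnalyticAt ℝ (fun h => Real.exp (μ h)) 0 := by
  have h : AnalyticAt ℝ (fun x : ℝ => (μC x).re) 0 :=
    AnalyticAt.re_ofReal (by simpa using analyticAt_μC)
  simp only [μC_ofReal, Complex.ofReal_re] at h
  exact h.rexp

/-- The Maclaurin coefficients of `exp (μ h)`. -/
noncomputable def expμCoeff (i : ℕ) : ℝ := coeffAtZero i (fun h => Real.exp (μ h))

theorem hasExpansion_exp_μ :
    HasExpansion (𝓝 0) (fun x => x) (fun h => Real.exp (μ h)) expμCoeff :=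
  hasExpansion_coeffAtZero analyticAt_exp_μ

end BGG

theorem HasExpansion.ofReal {ι : Type*} {l : Filter ι} {t f : ι → ℝ} {c : ℕ → ℝ}
    (h : HasExpansion l t f c) :
    HasExpansion l (fun x => (t x : ℂ)) (fun x => (f x : ℂ)) (fun n => (c n : ℂ)) := fun M => by
  have := h M
  refine IsBigO.of_norm_norm ?_
  refine this.norm_norm.congr (fun x => ?_) fun x => ?_
  · rw [← Complex.norm_real]; push_cast; rfl
  · rw [← Complex.norm_real]; push_cast; rfl

namespace BGG

/-- The complex Taylor coefficients are the real ones, by uniqueness along the positive real axis.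
-/
theorem hasExpansion_exp_μC :
    HasExpansion (𝓝 0) (fun x => x) (fun h => Complex.exp (μC h)) (fun i => (expμCoeff i : ℂ)) := by
  have h1 : HasExpansion (𝓝 0) (fun x => x) (fun h => Complex.exp (μC h))
      (fun n => iteratedDeriv n (fun h => Complex.exp (μC h)) 0 / (n.factorial : ℂ)) :=
    analyticAt_μC.cexp.hasExpansion
  have ht : Tendsto (fun x : ℝ => (x : ℂ)) (𝓝[>] 0) (𝓝 0) := by
    have := (Complex.continuous_ofReal.tendsto 0).mono_left (nhdsWithin_le_nhds (s := Set.Ioi 0))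
    simpa using this
  have h2 := h1.comp_tendsto ht
  have h3 := (hasExpansion_exp_μ.mono (nhdsWithin_le_nhds (s := Set.Ioi 0))).ofReal
  have h4 : (fun n => iteratedDeriv n (fun h => Complex.exp (μC h)) 0 / (n.factorial : ℂ)) =
      fun i => (expμCoeff i : ℂ) := by
    refine HasExpansion.unique ht ?_ h2 (h3.congr' (Eventually.of_forall fun x => ?_))
    · filter_upwards [eventually_mem_nhdsWithin] with x hx
      exact_mod_cast (ne_of_gt hx : x ≠ 0)
    · simp [μC_ofReal]
  rwa [h4] at h1

theorem hasExpansion_exp_neg_μC :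
    HasExpansion (𝓝 0) (fun x => x) (fun h => Complex.exp (-μC h))
      (fun i => (expμCoeff i : ℂ) * (-1) ^ i) := by
  have ht : Tendsto (fun x : ℂ => (-1 : ℂ) * x) (𝓝 0) (𝓝 0) := by
    have : Continuous fun x : ℂ => (-1 : ℂ) * x := by fun_prop
    simpa using this.tendsto 0
  refine (hasExpansion_exp_μC.comp_tendsto ht).scale.congr' ?_
  filter_upwards [Metric.ball_mem_nhds (0 : ℂ) one_pos] with z hz
  rw [neg_one_mul, μC_neg (by simpa using hz)]

/-- The bound μ ≤ 1/2 on the half-line amounts to (1 - x) e^x ≤ 1. The exponent 0 makes the global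
remainder bound a single power x^M. -/
theorem exp_μ_le {x : ℝ} (hx : 0 ≤ x) : |Real.exp (μ x)| ≤ Real.exp (1 / 2) * (1 + x) ^ 0 := by
  rw [abs_of_pos (Real.exp_pos _), pow_zero, mul_one, Real.exp_le_exp, μ]
  split_ifs with h0
  · norm_num
  have hx : 0 < x := lt_of_le_of_ne hx (Ne.symm h0)
  have he : 0 < Real.exp x - 1 := by linarith [Real.add_one_lt_exp h0]
  have h1 := Real.add_one_le_exp (-x)
  rw [Real.exp_neg] at h1
  have h2 : (-x + 1) * Real.exp x ≤ 1 := by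
    calc _ ≤ (Real.exp x)⁻¹ * Real.exp x := by gcongr
      _ = 1 := inv_mul_cancel₀ (Real.exp_ne_zero x)
  have h3 : 1 / x - 1 / (Real.exp x - 1) ≤ 1 := by
    rw [div_sub_div _ _ hx.ne' he.ne', div_le_one (by positivity)]
    nlinarith
  linarith

theorem measurable_μ : Measurable μ :=
  Measurable.ite (measurableSet_singleton 0) measurable_const (by fun_prop)

theorem exists_exp_μ_sub_le (M : ℕ) : ∃ A : ℝ, 0 ≤ A ∧ ∀ x, 0 ≤ x →
    |Real.exp (μ x) - ∑ i ∈ range M, expμCoeff i * x ^ i| ≤ A * x ^ M := by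
  obtain ⟨A, hA, h⟩ := (hasExpansion_exp_μ.mono nhdsWithin_le_nhds).exists_global_bound
    (fun x hx => exp_μ_le hx) M
  refine ⟨2 * A, by positivity, fun x hx => (h x hx).trans_eq ?_⟩
  rw [add_zero]; ring

theorem exp_neg_eq_exp_μ (s : ℝ) {h : ℝ} (hh : 0 < h) :
    Real.exp (-(s ^ 2 * h) - 1 / (Real.exp h - 1)) =
      Real.exp (1 / 2) * (Real.exp (-(s ^ 2 * h) - 1 / h) * Real.exp (μ h)) := by
  rw [← Real.exp_add, ← Real.exp_add, μ, if_neg hh.ne']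
  ring_nf

/-! ### Expansion of the Laplace integral through K_{i+1}. -/

/-- Each Taylor term of exp(μ) contributes a Bessel integral K_{i+1}(2s). The remainder is at most A
h^M, and integrating it gives s^{-M} times a normalized K_{M+1}, which is O(1). -/
theorem hasExpansion_laplace :
    HasExpansion atTop (fun s : ℝ => 1 / s)
      (fun s => √(s / Real.pi) * Real.exp (2 * s) * s * (Real.exp (-(1 / 2)) *
        ∫ h in Set.Ioi (0 : ℝ), Real.exp (-(s ^ 2 * h) - 1 / (Real.exp h - 1))))
      (fun m => ∑ i ∈ range (m + 1), expμCoeff i *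
        (coshKernelCoeff (i + 1) (m - i) * gaussianMoment (m - i))) := by
  refine HasExpansion.of_forall_isBigO (e := expμCoeff)
    (g := fun i s => √(s / Real.pi) * Real.exp (2 * s) * s ^ (i + 1) *
        ∫ h in Set.Ioi (0 : ℝ), h ^ i * Real.exp (-(s ^ 2 * h) - 1 / h))
    (q := fun i j => coshKernelCoeff (i + 1) j * gaussianMoment j)
    (fun M => ?_) hasExpansion_besselK
  obtain ⟨A, hA, hb⟩ := exists_exp_μ_sub_le M
  refine IsBigO.trans (g := fun s : ℝ => A * ((1 / s) ^ M *
    (√(s / Real.pi) * Real.exp (2 * s) * s ^ (M + 1) *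
        ∫ h in Set.Ioi (0 : ℝ), h ^ M * Real.exp (-(s ^ 2 * h) - 1 / h)))) ?_ ?_
  swap
  · refine IsBigO.const_mul_left ?_ A
    simpa using (isBigO_refl (fun s : ℝ => (1 / s) ^ M) atTop).mul
      (hasExpansion_besselK M).isBigO_one
  refine IsBigO.of_bound 1 ?_
  filter_upwards [eventually_gt_atTop 0] with s hs
  have e0 : Real.exp (-(1 / 2)) *
      ∫ h in Set.Ioi (0 : ℝ), Real.exp (-(s ^ 2 * h) - 1 / (Real.exp h - 1)) =
      ∫ h in Set.Ioi (0 : ℝ), Real.exp (-(s ^ 2 * h) - 1 / h) * Real.exp (μ h) := by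
    rw [setIntegral_congr_fun measurableSet_Ioi fun h hh => exp_neg_eq_exp_μ s hh,
      integral_const_mul, ← mul_assoc, ← Real.exp_add]
    simp
  have i0 : IntegrableOn (fun h => Real.exp (-(s ^ 2 * h) - 1 / h)) (Set.Ioi 0) := by
    simpa using integrableOn_besselIntegrand 0 hs
  have i1 : IntegrableOn (fun h => Real.exp (-(s ^ 2 * h) - 1 / h) * Real.exp (μ h))
      (Set.Ioi 0) := by
    refine (Integrable.const_mul i0 (Real.exp (1 / 2))).mono' ?_ ?_
    · exact (Measurable.mul (by fun_prop) measurable_μ.exp).aestronglyMeasurable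
    · filter_upwards [ae_restrict_mem measurableSet_Ioi] with h hh
      rw [norm_mul, Real.norm_of_nonneg (Real.exp_pos _).le, mul_comm]
      gcongr
      simpa using exp_μ_le (le_of_lt hh)
  have i2 : ∀ i, IntegrableOn (fun h => expμCoeff i * (h ^ i * Real.exp (-(s ^ 2 * h) - 1 / h)))
      (Set.Ioi 0) := fun i => Integrable.const_mul (integrableOn_besselIntegrand i hs) _
  have e1 : ∫ h in Set.Ioi (0 : ℝ), Real.exp (-(s ^ 2 * h) - 1 / h) *
        (Real.exp (μ h) - ∑ i ∈ range M, expμCoeff i * h ^ i) =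
      (∫ h in Set.Ioi (0 : ℝ), Real.exp (-(s ^ 2 * h) - 1 / h) * Real.exp (μ h)) -
      ∑ i ∈ range M, expμCoeff i *
        ∫ h in Set.Ioi (0 : ℝ), h ^ i * Real.exp (-(s ^ 2 * h) - 1 / h) := by
    simp only [← integral_const_mul]
    rw [← integral_finsetSum _ fun i _ => i2 i,
      ← integral_sub i1 (integrable_finsetSum _ fun i _ => i2 i)]
    congr 1 with h
    rw [mul_sub, mul_sum]
    congr 1
    exact sum_congr rfl fun i _ => by ring
  have e2 : √(s / Real.pi) * Real.exp (2 * s) * s * (Real.exp (-(1 / 2)) *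
        ∫ h in Set.Ioi (0 : ℝ), Real.exp (-(s ^ 2 * h) - 1 / (Real.exp h - 1))) -
      ∑ i ∈ range M, expμCoeff i * (1 / s) ^ i * (√(s / Real.pi) * Real.exp (2 * s) * s ^ (i + 1) *
        ∫ h in Set.Ioi (0 : ℝ), h ^ i * Real.exp (-(s ^ 2 * h) - 1 / h)) =
      √(s / Real.pi) * Real.exp (2 * s) * s *
        ∫ h in Set.Ioi (0 : ℝ), Real.exp (-(s ^ 2 * h) - 1 / h) *
          (Real.exp (μ h) - ∑ i ∈ range M, expμCoeff i * h ^ i) := by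
    rw [e1, e0, mul_sub, mul_sum]
    congr 1
    refine sum_congr rfl fun i _ => ?_
    rw [one_div_pow]
    field_simp
    ring
  rw [e2, one_mul, norm_mul, Real.norm_of_nonneg (by positivity)]
  have e3 : ‖∫ h in Set.Ioi (0 : ℝ), Real.exp (-(s ^ 2 * h) - 1 / h) *
      (Real.exp (μ h) - ∑ i ∈ range M, expμCoeff i * h ^ i)‖ ≤
      ∫ h in Set.Ioi (0 : ℝ), A * (h ^ M * Real.exp (-(s ^ 2 * h) - 1 / h)) := by
    refine norm_integral_le_of_norm_le (Integrable.const_mul (integrableOn_besselIntegrand M hs) _)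
      ?_
    filter_upwards [ae_restrict_mem measurableSet_Ioi] with h hh
    rw [norm_mul, Real.norm_of_nonneg (Real.exp_pos _).le, Real.norm_eq_abs]
    calc _ ≤ Real.exp (-(s ^ 2 * h) - 1 / h) * (A * h ^ M) := by gcongr; exact hb h (le_of_lt hh)
      _ = _ := by ring
  rw [integral_const_mul] at e3
  refine (mul_le_mul_of_nonneg_left e3 (by positivity)).trans ((le_abs_self _).trans_eq' ?_)
  rw [one_div_pow]
  field_simp
  ring

/-! ### The coefficients `b n` as Laplace integrals. -/

theorem hasFPowerSeriesAt_of_hasSum {f : ℝ → ℝ} {c : ℕ → ℝ}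
    (h : ∀ᶠ z in 𝓝 (0 : ℝ), HasSum (fun n => z ^ n * c n) (f z)) :
    HasFPowerSeriesAt f (FormalMultilinearSeries.ofScalars ℝ c) 0 := by
  rw [hasFPowerSeriesAt_iff]
  filter_upwards [h] with z hz
  simpa [FormalMultilinearSeries.coeff_ofScalars] using hz

theorem coeffAtZero_of_hasSum {f : ℝ → ℝ} {c : ℕ → ℝ}
    (h : ∀ᶠ z in 𝓝 (0 : ℝ), HasSum (fun n => z ^ n * c n) (f z)) (n : ℕ) :
    coeffAtZero n f = c n := by
  have h1 := hasFPowerSeriesAt_of_hasSum h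
  have h2 := h1.eq_formalMultilinearSeries h1.analyticAt.hasFPowerSeriesAt
  have h3 := congrArg (fun p => FormalMultilinearSeries.coeff p n) h2
  simp only [FormalMultilinearSeries.coeff_ofScalars] at h3
  exact h3.symm

/-- The Laplace integral `∫_0^∞ exp (-n h - 1 / (exp h - 1)) dh`. -/
noncomputable def laplace (n : ℕ) : ℝ :=
  ∫ h in Set.Ioi (0 : ℝ), Real.exp (-(n * h) - 1 / (Real.exp h - 1))

theorem exp_sub_one_pos {h : ℝ} (hh : 0 < h) : 0 < Real.exp h - 1 := by
  linarith [Real.add_one_lt_exp hh.ne']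

theorem laplace_integrand_le (n : ℕ) {h : ℝ} (hh : 0 < h) :
    Real.exp (-(n * h) - 1 / (Real.exp h - 1)) ≤ Real.exp (-(n * h)) := by
  have := exp_sub_one_pos hh
  rw [Real.exp_le_exp]
  have : 0 < 1 / (Real.exp h - 1) := by positivity
  linarith

theorem integrableOn_exp_neg_nat_mul {n : ℕ} (hn : 1 ≤ n) :
    IntegrableOn (fun h : ℝ => Real.exp (-(n * h))) (Set.Ioi 0) := by
  have : (0 : ℝ) < n := by exact_mod_cast hn
  simpa [neg_mul] using integrableOn_exp_mul_Ioi (neg_lt_zero.2 this) 0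

theorem integrableOn_laplace {n : ℕ} (hn : 1 ≤ n) :
    IntegrableOn (fun h : ℝ => Real.exp (-(n * h) - 1 / (Real.exp h - 1))) (Set.Ioi 0) := by
  refine Integrable.mono' (integrableOn_exp_neg_nat_mul hn)
    (Measurable.aestronglyMeasurable (by fun_prop)) ?_
  filter_upwards [ae_restrict_mem measurableSet_Ioi] with h hh
  rw [Real.norm_of_nonneg (Real.exp_pos _).le]
  exact laplace_integrand_le n hh

theorem laplace_le_one {n : ℕ} (hn : 1 ≤ n) : laplace n ≤ 1 := by
  have h1 : laplace n ≤ ∫ h in Set.Ioi (0 : ℝ), Real.exp (-h) := by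
    refine setIntegral_mono_on (integrableOn_laplace hn)
      (by simpa using integrableOn_exp_neg_nat_mul le_rfl) measurableSet_Ioi fun h hh => ?_
    refine (laplace_integrand_le n hh).trans (Real.exp_le_exp.2 ?_)
    have h1 : (1 : ℝ) ≤ n := by exact_mod_cast hn
    have h2 : (0 : ℝ) < h := hh
    nlinarith
  rwa [integral_exp_neg_Ioi_zero] at h1

theorem image_one_div_exp_sub_one :
    (fun h : ℝ => 1 / (Real.exp h - 1)) '' Set.Ioi 0 = Set.Ioi 0 := by
  ext y
  simp only [Set.mem_image, Set.mem_Ioi]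
  constructor
  · rintro ⟨h, hh, rfl⟩
    have := exp_sub_one_pos hh
    positivity
  · intro hy
    refine ⟨Real.log (1 + 1 / y), Real.log_pos ?_, ?_⟩
    · have : 0 < 1 / y := by positivity
      linarith
    · rw [Real.exp_log (by positivity)]; field_simp; ring

theorem hasDerivAt_one_div_exp_sub_one {h : ℝ} (hh : 0 < h) :
    HasDerivAt (fun h : ℝ => 1 / (Real.exp h - 1)) (-Real.exp h / (Real.exp h - 1) ^ 2) h := by
  simp only [one_div]
  exact ((Real.hasDerivAt_exp h).sub_const 1).inv (exp_sub_one_pos hh).ne'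

theorem integral_comp_one_div_exp_sub_one (g : ℝ → ℝ) :
    ∫ s in Set.Ioi (0 : ℝ), g s = ∫ h in Set.Ioi (0 : ℝ),
      Real.exp h / (Real.exp h - 1) ^ 2 * g (1 / (Real.exp h - 1)) := by
  have h := integral_image_eq_integral_abs_deriv_smul (measurableSet_Ioi (a := (0 : ℝ)))
    (fun h hh => (hasDerivAt_one_div_exp_sub_one hh).hasDerivWithinAt)
    (fun u hu v hv huv => by
      have h1 := exp_sub_one_pos hu
      have h2 := exp_sub_one_pos hv
      simp only [one_div, inv_inj, sub_left_inj] at huv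
      exact Real.exp_injective huv) g
  rw [image_one_div_exp_sub_one] at h
  rw [h]
  refine setIntegral_congr_fun measurableSet_Ioi fun h hh => ?_
  have := exp_sub_one_pos hh
  simp only [smul_eq_mul]
  rw [neg_div, abs_neg, abs_of_pos (by positivity)]

theorem exp_mul_E₁ (x : ℝ) :
    Real.exp x * E₁ x = ∫ s in Set.Ioi (0 : ℝ), Real.exp (-s) / (s + x) := by
  have h := (measurePreserving_add_right volume x).setIntegral_preimage_emb
    (measurableEmbedding_addRight x) (fun t : ℝ => Real.exp (-t) / t) (Set.Ioi x)
  rw [Set.preimage_add_const_Ioi, sub_self] at h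
  rw [E₁, ← h, ← integral_const_mul]
  refine integral_congr_ae (Eventually.of_forall fun s => ?_)
  simp only
  rw [← mul_div_assoc, ← Real.exp_add]
  ring_nf

theorem integrableOn_exp_neg_div_add {x : ℝ} (hx : 0 < x) :
    IntegrableOn (fun s => Real.exp (-s) / (s + x)) (Set.Ioi 0) := by
  have h1 : IntegrableOn (fun s : ℝ => Real.exp (-s)) (Set.Ioi 0) := by
    simpa using integrableOn_exp_neg_nat_mul le_rfl
  refine (Integrable.const_mul h1 (1 / x)).mono'
    (Measurable.aestronglyMeasurable (by fun_prop)) ?_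
  filter_upwards [ae_restrict_mem measurableSet_Ioi] with s hs
  have hs : 0 < s := hs
  rw [Real.norm_of_nonneg (by positivity), mul_comm, mul_one_div]
  gcongr
  linarith

/-- Write e^x E₁(x) as ∫ e^{-s}/(s + x) ds and put s = 1/(e^h - 1). Subtracting the value at z = 0
removes the constant term, whose own integral would diverge at infinity. -/
theorem f₁_sub_f₁_zero {z : ℝ} (hz : |z| < 1) :
    f₁ z - f₁ 0 = ∫ h in Set.Ioi (0 : ℝ),
      -(z / (Real.exp h - z)) * Real.exp (-(1 / (Real.exp h - 1))) := by
  have hz1 : 0 < 1 - z := by linarith [(abs_lt.1 hz).2]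
  have hx : 0 < 1 / (1 - z) := by positivity
  rw [f₁, f₁, exp_mul_E₁, exp_mul_E₁, ← integral_sub (integrableOn_exp_neg_div_add hx)
    (integrableOn_exp_neg_div_add (by norm_num)), integral_comp_one_div_exp_sub_one]
  refine setIntegral_congr_fun measurableSet_Ioi fun h hh => ?_
  have h1 := exp_sub_one_pos hh
  have h2 := Real.exp_pos h
  have h3 : 0 < Real.exp h - z := by linarith
  simp only [sub_zero, div_one]
  have h4 : 1 / (Real.exp h - 1) + 1 / (1 - z) =
      (Real.exp h - z) / ((Real.exp h - 1) * (1 - z)) := by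
    field_simp; ring
  have h5 : 1 / (Real.exp h - 1) + 1 = Real.exp h / (Real.exp h - 1) := by
    field_simp; ring
  rw [h4, h5]
  field_simp
  ring

/-- Expand z/(e^h - z) as a geometric series in z e^{-h} and integrate termwise; the bound
`laplace_le_one` makes the series of norms converge. -/
theorem hasSum_f₁ {z : ℝ} (hz : |z| < 1) :
    HasSum (fun n : ℕ => z ^ (n + 1) * -laplace (n + 1)) (f₁ z - f₁ 0) := by
  have hF : ∀ n : ℕ, IntegrableOn (fun h : ℝ => -(z ^ (n + 1)) *
      Real.exp (-((n + 1 : ℕ) * h) - 1 / (Real.exp h - 1))) (Set.Ioi 0) :=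
    fun n => Integrable.const_mul (integrableOn_laplace (by omega)) _
  have hs := hasSum_integral_of_summable_integral_norm hF (by
    refine Summable.of_nonneg_of_le (fun n => integral_nonneg fun _ => norm_nonneg _)
      (fun n => ?_) (summable_geometric_of_lt_one (abs_nonneg z) hz)
    simp only [norm_mul, norm_neg, norm_pow, Real.norm_of_nonneg (Real.exp_pos _).le,
      Real.norm_eq_abs]
    rw [integral_const_mul]
    calc |z| ^ (n + 1) * laplace (n + 1) ≤ |z| ^ (n + 1) * 1 := by
          gcongr; exact laplace_le_one (by omega)
      _ ≤ |z| ^ n := by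
          rw [mul_one]; exact pow_le_pow_of_le_one (abs_nonneg z) hz.le (by omega))
  have e1 : ∀ n : ℕ, ∫ h in Set.Ioi (0 : ℝ), -(z ^ (n + 1)) *
      Real.exp (-((n + 1 : ℕ) * h) - 1 / (Real.exp h - 1)) = z ^ (n + 1) * -laplace (n + 1) :=
    fun n => by rw [integral_const_mul, laplace, neg_mul, mul_neg]
  have e2 : ∫ h in Set.Ioi (0 : ℝ), ∑' n : ℕ, -(z ^ (n + 1)) *
      Real.exp (-((n + 1 : ℕ) * h) - 1 / (Real.exp h - 1)) = f₁ z - f₁ 0 := by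
    rw [f₁_sub_f₁_zero hz]
    refine setIntegral_congr_fun measurableSet_Ioi fun h hh => ?_
    have h1 := exp_sub_one_pos hh
    have h2 := Real.exp_pos h
    have hz1 := (abs_lt.1 hz).2
    have h3 : 0 < Real.exp h - z := by linarith
    have hr : |z * Real.exp (-h)| < 1 := by
      rw [abs_mul, abs_of_pos (Real.exp_pos _)]
      refine mul_lt_one_of_nonneg_of_lt_one_left (abs_nonneg z) hz ?_
      rw [Real.exp_le_one_iff]; exact (neg_lt_zero.2 hh).le
    have hg := (hasSum_geometric_of_abs_lt_one hr).mul_left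
      (-(z * Real.exp (-h)) * Real.exp (-(1 / (Real.exp h - 1))))
    have e : ∀ n : ℕ, -(z * Real.exp (-h)) * Real.exp (-(1 / (Real.exp h - 1))) *
        (z * Real.exp (-h)) ^ n =
        -(z ^ (n + 1)) * Real.exp (-((n + 1 : ℕ) * h) - 1 / (Real.exp h - 1)) := fun n => by
      rw [sub_eq_add_neg _ (1 / _), Real.exp_add, ← mul_neg _ h, Real.exp_nat_mul, mul_pow]
      ring
    simp only [e] at hg
    rw [hg.tsum_eq, Real.exp_neg h]
    field_simp
  simp only [e1] at hs
  rwa [e2] at hs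

theorem hasSum_f₁_pow {z : ℝ} (hz : |z| < 1) :
    HasSum (fun n : ℕ => z ^ n * if n = 0 then f₁ 0 else -laplace n) (f₁ z) := by
  rw [← hasSum_nat_add_iff' 1]
  simpa using hasSum_f₁ hz

theorem b_eq {n : ℕ} (hn : n ≠ 0) : b n = -laplace n := by
  have := coeffAtZero_of_hasSum (f := f₁) (c := fun n => if n = 0 then f₁ 0 else -laplace n) (by
    filter_upwards [Metric.ball_mem_nhds (0 : ℝ) one_pos] with z hz
    exact hasSum_f₁_pow (by simpa using hz)) n
  rw [b, this, if_neg hn]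

/-! ### Second-order recurrences for the Laplace integral and for `a n`. -/

/-- Integrate the derivative of (1 - e^{-h})² exp(-mh - 1/(e^h-1)). The square clears the
denominator produced by differentiating 1/(e^h-1) and kills the boundary term at 0; m ≥ 1 kills the
one at infinity. -/
theorem laplace_recurrence {m : ℕ} (hm : 1 ≤ m) :
    ((m : ℝ) + 2) * laplace (m + 2) - (2 * m + 3) * laplace (m + 1) + m * laplace m = 0 := by
  have hd : ∀ h ∈ Set.Ioi (0 : ℝ), HasDerivAt
      (fun h => (1 - Real.exp (-h)) ^ 2 * Real.exp (-(m * h) - 1 / (Real.exp h - 1)))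
      ((-((m : ℝ) + 2)) * Real.exp (-((m + 2 : ℕ) * h) - 1 / (Real.exp h - 1)) +
        (2 * m + 3) * Real.exp (-((m + 1 : ℕ) * h) - 1 / (Real.exp h - 1)) +
        -(m : ℝ) * Real.exp (-(m * h) - 1 / (Real.exp h - 1))) h := by
    intro h hh
    have h1 := exp_sub_one_pos hh
    have h2 := Real.exp_pos h
    have hE : HasDerivAt (fun h => Real.exp (-(m * h) - 1 / (Real.exp h - 1)))
        (Real.exp (-(m * h) - 1 / (Real.exp h - 1)) *
          (-(m : ℝ) - -Real.exp h / (Real.exp h - 1) ^ 2)) h := by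
      refine HasDerivAt.exp (HasDerivAt.sub ?_ (hasDerivAt_one_div_exp_sub_one hh))
      exact ((hasDerivAt_id' h).const_mul (m : ℝ)).neg.congr_deriv (by ring)
    have hq : HasDerivAt (fun h => (1 - Real.exp (-h)) ^ 2)
        (2 * (1 - Real.exp (-h)) * Real.exp (-h)) h := by
      have := (((hasDerivAt_id' h).neg.exp).const_sub 1).pow 2
      exact this.congr_deriv (by simp)
    refine (hq.mul hE).congr_deriv ?_
    have e1 : Real.exp (-((m + 1 : ℕ) * h) - 1 / (Real.exp h - 1)) =
        Real.exp (-h) * Real.exp (-(m * h) - 1 / (Real.exp h - 1)) := by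
      rw [← Real.exp_add]; push_cast; ring_nf
    have e2 : Real.exp (-((m + 2 : ℕ) * h) - 1 / (Real.exp h - 1)) =
        Real.exp (-h) ^ 2 * Real.exp (-(m * h) - 1 / (Real.exp h - 1)) := by
      rw [← Real.exp_nat_mul, ← Real.exp_add]; push_cast; ring_nf
    rw [e1, e2, Real.exp_neg]
    generalize Real.exp (-(m * h) - 1 / (Real.exp h - 1)) = X
    generalize Real.exp h = y at *
    field_simp
    ring
  have hbound : ∀ h : ℝ, 0 < h →
      ‖(1 - Real.exp (-h)) ^ 2 * Real.exp (-(m * h) - 1 / (Real.exp h - 1))‖ ≤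
        (1 - Real.exp (-h)) ^ 2 * Real.exp (-h) := fun h hh => by
    rw [Real.norm_of_nonneg (by positivity)]
    refine mul_le_mul_of_nonneg_left ((laplace_integrand_le m hh).trans ?_) (sq_nonneg _)
    have : (1 : ℝ) ≤ m := by exact_mod_cast hm
    rw [Real.exp_le_exp]; nlinarith
  -- At h = 0 the quotient 1/(e^h - 1) takes the default value 0, which is harmless since the
  -- squared factor vanishes there.
  have hcont : ContinuousWithinAt
      (fun h => (1 - Real.exp (-h)) ^ 2 * Real.exp (-(m * h) - 1 / (Real.exp h - 1)))
      (Set.Ici 0) 0 := by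
    rw [← continuousWithinAt_Ioi_iff_Ici, ContinuousWithinAt]
    have hc : Continuous fun h : ℝ => (1 - Real.exp (-h)) ^ 2 * Real.exp (-h) := by fun_prop
    have h0 := (hc.tendsto 0).mono_left (nhdsWithin_le_nhds (s := Set.Ioi 0))
    simp only [neg_zero, Real.exp_zero, sub_self, ne_eq, OfNat.ofNat_ne_zero, not_false_eq_true,
      zero_pow, zero_mul] at h0 ⊢
    exact squeeze_zero_norm' (eventually_mem_nhdsWithin.mono hbound) h0
  have htop : Tendsto
      (fun h => (1 - Real.exp (-h)) ^ 2 * Real.exp (-(m * h) - 1 / (Real.exp h - 1)))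
      atTop (𝓝 0) := by
    have h1 : Tendsto (fun h : ℝ => Real.exp (-h)) atTop (𝓝 0) := Real.tendsto_exp_neg_atTop_nhds_zero
    have h2 := ((h1.const_sub 1).pow 2).mul h1
    rw [mul_zero] at h2
    exact squeeze_zero_norm' ((eventually_gt_atTop 0).mono hbound) h2
  have i0 := Integrable.const_mul (integrableOn_laplace hm) (-(m : ℝ))
  have i1 := Integrable.const_mul (integrableOn_laplace (n := m + 1) (by omega)) (2 * (m : ℝ) + 3)
  have i2 := Integrable.const_mul (integrableOn_laplace (n := m + 2) (by omega)) (-((m : ℝ) + 2))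
  have h := integral_Ioi_of_hasDerivAt_of_tendsto hcont hd ((i2.add i1).add i0) htop
  have h' := integral_add (i2.add i1) i0
  have h'' := integral_add i2 i1
  simp only [Pi.add_apply] at h h' h''
  rw [h', h'', integral_const_mul, integral_const_mul, integral_const_mul] at h
  simp only [neg_zero, Real.exp_zero, sub_self, ne_eq, OfNat.ofNat_ne_zero, not_false_eq_true,
      zero_pow, zero_mul] at h
  simp only [laplace]
  linarith

theorem analyticAt_f₀ : AnalyticAt ℝ f₀ 0 := by
  have : AnalyticAt ℝ (fun z : ℝ => z / (1 - z)) 0 :=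
    analyticAt_id.div (analyticAt_const.sub analyticAt_id) (by simp)
  exact this.rexp

theorem deriv_f₀ {z : ℝ} (hz : z < 1) : deriv f₀ z = f₀ z / (1 - z) ^ 2 := by
  have hz' : 1 - z ≠ 0 := by linarith
  have h := (((hasDerivAt_id' z).div ((hasDerivAt_id' z).const_sub 1) hz').exp).deriv
  refine h.trans ?_
  simp only [f₀]
  field_simp
  simp

theorem coeffAtZero_deriv (n : ℕ) (f : ℝ → ℝ) :
    coeffAtZero n (deriv f) = (n + 1) * coeffAtZero (n + 1) f := by
  rw [coeffAtZero, coeffAtZero, ← iteratedDeriv_succ', Nat.factorial_succ]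
  have : (n.factorial : ℝ) ≠ 0 := by positivity
  push_cast
  field_simp

theorem a_zero : a 0 = 1 := by simp [a, coeffAtZero, f₀]

/-- The differential equation f₀ = (1 - z)² f₀', read on coefficients. -/
theorem hasExpansion_f₀_identity : (fun n => coeffAtZero n f₀) = fun n =>
    coeffAtZero n (deriv f₀) - 2 * (if n = 0 then 0 else coeffAtZero (n - 1) (deriv f₀)) +
      (if n < 2 then 0 else coeffAtZero (n - 2) (deriv f₀)) := by
  have hd := hasExpansion_coeffAtZero analyticAt_f₀.deriv
  have h := (hd.sub ((hd.var_mul isBigO_id_one).const_mul 2)).add (hd.pow_mul isBigO_id_one 2)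
  refine HasExpansion.unique_nhds_zero
    ((hasExpansion_coeffAtZero analyticAt_f₀).mono nhdsWithin_le_nhds)
    ((h.congr' ?_).mono nhdsWithin_le_nhds)
  filter_upwards [Iio_mem_nhds (zero_lt_one (α := ℝ))] with z hz
  have hz : z < 1 := hz
  have hz' : 1 - z ≠ 0 := by linarith
  rw [deriv_f₀ hz]
  field_simp
  ring

theorem a_one : a 1 = 1 := by
  have h := congrFun hasExpansion_f₀_identity 0
  simp only [coeffAtZero_deriv] at h
  simp only [CharP.cast_eq_zero, zero_add, one_mul, if_true, mul_zero, sub_zero,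
    Nat.zero_lt_two, add_zero] at h
  exact h.symm.trans a_zero

theorem a_recurrence (m : ℕ) :
    ((m : ℝ) + 2) * a (m + 2) - (2 * m + 3) * a (m + 1) + m * a m = 0 := by
  have h := congrFun hasExpansion_f₀_identity (m + 1)
  simp only [coeffAtZero_deriv] at h
  rcases m with _ | m
  · simp at h
    simp only [a]
    norm_num
    linarith
  · simp at h
    simp only [a]
    push_cast
    linarith

/-! ### The coefficients `a n` as contour integrals. -/

/-- The integrand of the contour integral representing `a n`. -/
noncomputable def contourIntegrand (x : ℂ) (h : ℂ) : ℂ :=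
  Complex.exp (x * h + 1 / (Complex.exp h - 1))

theorem hasDerivAt_one_div_cexp_sub_one {h : ℂ} (he : Complex.exp h - 1 ≠ 0) :
    HasDerivAt (fun h : ℂ => 1 / (Complex.exp h - 1))
      (-Complex.exp h / (Complex.exp h - 1) ^ 2) h := by
  simp only [one_div]
  exact ((Complex.hasDerivAt_exp h).sub_const 1).inv he

theorem cexp_sub_one_ne_zero_of_mem_sphere {r : ℝ} (hr : 0 < r) (hr1 : r < 1) {h : ℂ}
    (hh : h ∈ Metric.sphere (0 : ℂ) r) : Complex.exp h - 1 ≠ 0 := by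
  have hn : ‖h‖ = r := by simpa using hh
  exact exp_sub_one_ne_zero (norm_pos_iff.1 (hn ▸ hr)) (hn ▸ hr1)

theorem continuousOn_contourIntegrand {r : ℝ} (hr : 0 < r) (hr1 : r < 1) (x : ℂ) :
    ContinuousOn (contourIntegrand x) (Metric.sphere 0 r) := by
  intro h hh
  have he := cexp_sub_one_ne_zero_of_mem_sphere hr hr1 hh
  refine ContinuousAt.continuousWithinAt ?_
  unfold contourIntegrand
  fun_prop (disch := assumption)

theorem circleIntegrable_contourIntegrand {r : ℝ} (hr : 0 < r) (hr1 : r < 1) (x : ℂ) :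
    CircleIntegrable (contourIntegrand x) 0 r :=
  (continuousOn_contourIntegrand hr hr1 x).circleIntegrable hr.le

/-- The combination is the derivative of (e^h - 1)² exp(mh + 1/(e^h-1)) along a closed curve, so no
boundary term arises and m = 0 is allowed. -/
theorem circleIntegral_contourIntegrand_recurrence {r : ℝ} (hr : 0 < r) (hr1 : r < 1) (m : ℕ) :
    ((m : ℂ) + 2) * (∮ h in C(0, r), contourIntegrand (m + 2 : ℕ) h) -
      (2 * m + 3) * (∮ h in C(0, r), contourIntegrand (m + 1 : ℕ) h) +
      m * (∮ h in C(0, r), contourIntegrand m h) = 0 := by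
  have hd : ∀ h ∈ Metric.sphere (0 : ℂ) r, HasDerivWithinAt
      (fun h => (Complex.exp h - 1) ^ 2 * contourIntegrand m h)
      (((m : ℂ) + 2) * contourIntegrand (m + 2 : ℕ) h -
        (2 * m + 3) * contourIntegrand (m + 1 : ℕ) h + m * contourIntegrand m h)
      (Metric.sphere 0 r) h := by
    intro h hh
    have he := cexp_sub_one_ne_zero_of_mem_sphere hr hr1 hh
    refine HasDerivAt.hasDerivWithinAt ?_
    have hE : HasDerivAt (contourIntegrand m)
        (contourIntegrand m h * (m + -Complex.exp h / (Complex.exp h - 1) ^ 2)) h := by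
      refine HasDerivAt.cexp (HasDerivAt.add ?_ (hasDerivAt_one_div_cexp_sub_one he))
      exact ((hasDerivAt_id' h).const_mul (m : ℂ)).congr_deriv (by ring)
    have hq : HasDerivAt (fun h => (Complex.exp h - 1) ^ 2)
        (2 * (Complex.exp h - 1) * Complex.exp h) h :=
      (((Complex.hasDerivAt_exp h).sub_const 1).pow 2).congr_deriv (by simp)
    refine (hq.mul hE).congr_deriv ?_
    have e1 : contourIntegrand (m + 1 : ℕ) h = Complex.exp h * contourIntegrand m h := by
      rw [contourIntegrand, contourIntegrand, ← Complex.exp_add]; push_cast; ring_nf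
    have e2 : contourIntegrand (m + 2 : ℕ) h = Complex.exp h ^ 2 * contourIntegrand m h := by
      rw [contourIntegrand, contourIntegrand, ← Complex.exp_nat_mul, ← Complex.exp_add]
      push_cast; ring_nf
    rw [e1, e2]
    generalize contourIntegrand m h = X
    generalize Complex.exp h = y at *
    field_simp
    ring
  have h := circleIntegral.integral_eq_zero_of_hasDerivWithinAt hr.le hd
  have i := circleIntegrable_contourIntegrand hr hr1
  have j : ∀ (k x : ℂ), CircleIntegrable (fun h => k * contourIntegrand x h) 0 r := fun k x =>
    (continuousOn_const.mul (continuousOn_contourIntegrand hr hr1 x)).circleIntegrable hr.le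
  rw [circleIntegral.integral_add, circleIntegral.integral_sub (j _ _) (j _ _),
    circleIntegral.integral_const_mul, circleIntegral.integral_const_mul,
    circleIntegral.integral_const_mul] at h
  · exact h
  · exact ((continuousOn_const.mul (continuousOn_contourIntegrand hr hr1 _)).sub
      (continuousOn_const.mul (continuousOn_contourIntegrand hr hr1 _))).circleIntegrable hr.le
  · exact j _ _

theorem one_div_cexp_sub_one_eq {h : ℂ} (h0 : h ≠ 0) :
    1 / (Complex.exp h - 1) = 1 / h - 1 / 2 - μC h := by
  rw [μC, if_neg h0]; ring

theorem differentiableAt_μC {h : ℂ} (hh : ‖h‖ < 1) : DifferentiableAt ℂ μC h := by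
  by_cases h0 : h = 0
  · rw [h0]; exact analyticAt_μC.differentiableAt
  have he := exp_sub_one_ne_zero h0 hh
  have hd : DifferentiableAt ℂ (fun h : ℂ => 1 / h - 1 / (Complex.exp h - 1) - 1 / 2) h := by
    fun_prop (disch := assumption)
  refine hd.congr_of_eventuallyEq ?_
  filter_upwards [isOpen_ne.mem_nhds h0] with w hw
  rw [μC, if_neg hw]

/-- On the circle e^h/(e^h - 1) = 1/h + (1/2 - μ(h)), and the bracket is holomorphic in the disc. -/
theorem circleIntegral_cexp_div {r : ℝ} (hr : 0 < r) (hr1 : r < 1) :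
    (∮ h in C(0, r), Complex.exp h * (1 / (Complex.exp h - 1))) = 2 * Real.pi * Complex.I := by
  have hcont : ContinuousOn (fun h => 1 / 2 - μC h) (Metric.closedBall 0 r) := fun h hh => by
    have : ‖h‖ ≤ r := by simpa using hh
    exact (continuousAt_const.sub
      (differentiableAt_μC (this.trans_lt hr1)).continuousAt).continuousWithinAt
  have h1 : ∀ h ∈ Metric.sphere (0 : ℂ) r,
      Complex.exp h * (1 / (Complex.exp h - 1)) = (h - 0)⁻¹ + (1 / 2 - μC h) := fun h hh => by
    have he := cexp_sub_one_ne_zero_of_mem_sphere hr hr1 hh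
    have h0 : h ≠ 0 := by
      rintro rfl
      simp [hr.ne] at hh
    have : Complex.exp h * (1 / (Complex.exp h - 1)) = 1 + 1 / (Complex.exp h - 1) := by
      field_simp; ring
    rw [this, one_div_cexp_sub_one_eq h0]
    simp only [sub_zero, one_div]
    ring
  rw [circleIntegral.integral_congr hr.le h1, circleIntegral.integral_add,
    circleIntegral.integral_sub_center_inv 0 hr.ne',
    Complex.circleIntegral_eq_zero_of_differentiable_on_off_countable hr.le Set.countable_empty
      hcont, add_zero]
  · rintro h ⟨hh, -⟩
    have : ‖h‖ < r := by simpa using hh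
    exact (differentiableAt_const _).sub (differentiableAt_μC (this.trans hr1))
  · refine ContinuousOn.circleIntegrable hr.le (ContinuousOn.inv₀ (by fun_prop) ?_)
    rintro h hh h0
    rw [sub_zero] at h0
    simp [h0, hr.ne] at hh
  · exact (hcont.mono Metric.sphere_subset_closedBall).circleIntegrable hr.le

theorem circleIntegral_cexp_div_pow {r : ℝ} (hr : 0 < r) (hr1 : r < 1) (k : ℕ) :
    (∮ h in C(0, r), Complex.exp h * (1 / (Complex.exp h - 1)) ^ (k + 2)) = 0 := by
  refine circleIntegral.integral_eq_zero_of_hasDerivWithinAt hr.le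
    (f := fun h => -(1 / ((k : ℂ) + 1)) * (1 / (Complex.exp h - 1)) ^ (k + 1)) fun h hh => ?_
  have he := cexp_sub_one_ne_zero_of_mem_sphere hr hr1 hh
  have hk : (k : ℂ) + 1 ≠ 0 := by exact_mod_cast k.succ_ne_zero
  refine ((((hasDerivAt_one_div_cexp_sub_one he).pow (k + 1)).const_mul
    (-(1 / ((k : ℂ) + 1)))).congr_deriv ?_).hasDerivWithinAt
  simp only [add_tsub_cancel_right, one_div_pow, Nat.cast_add, Nat.cast_one]
  field_simp
  ring

theorem circleIntegral_cexp {r : ℝ} (hr : 0 < r) :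
    (∮ h in C(0, r), Complex.exp h * (1 / (Complex.exp h - 1)) ^ 0) = 0 := by
  refine circleIntegral.integral_eq_zero_of_hasDerivWithinAt hr.le
    (f := Complex.exp) fun h hh => ?_
  simpa using (Complex.hasDerivAt_exp h).hasDerivWithinAt

/-- Expand exp(1/(e^h-1)) in its exponential series. The terms e^h (e^h-1)^{-k} have primitives on
the circle except for k = 1, which contributes 2πi. -/
theorem circleIntegral_contourIntegrand_one {r : ℝ} (hr : 0 < r) (hr1 : r < 1) :
    (∮ h in C(0, r), contourIntegrand 1 h) = 2 * Real.pi * Complex.I := by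
  -- From |e^h - 1 - h| ≤ r² on the circle, |e^h - 1| ≥ r - r².
  set W : ℝ := 1 / (r - r ^ 2) with hW
  have hden : 0 < r - r ^ 2 := by nlinarith
  have hWpos : 0 < W := by positivity
  have hbound : ∀ h ∈ Metric.sphere (0 : ℂ) r, ‖1 / (Complex.exp h - 1)‖ ≤ W := fun h hh => by
    have hn : ‖h‖ = r := by simpa using hh
    have h2 := Complex.norm_exp_sub_one_sub_id_le (x := h) (by linarith)
    have h3 := norm_sub_norm_le h (h - (Complex.exp h - 1))
    rw [sub_sub_cancel, norm_sub_rev h] at h3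
    rw [norm_div, norm_one, hW]
    refine one_div_le_one_div_of_le hden ?_
    rw [hn] at h2 h3
    linarith
  have hsum : HasSum (fun k : ℕ => ∫ θ in (0 : ℝ)..(2 * Real.pi), deriv (circleMap 0 r) θ •
      ((1 / (k.factorial : ℂ)) * (Complex.exp (circleMap 0 r θ) *
        (1 / (Complex.exp (circleMap 0 r θ) - 1)) ^ k)))
      (∫ θ in (0 : ℝ)..(2 * Real.pi), deriv (circleMap 0 r) θ •
        contourIntegrand 1 (circleMap 0 r θ)) := by
    have hmem : ∀ θ, circleMap 0 r θ ∈ Metric.sphere (0 : ℂ) r := fun θ =>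
      circleMap_mem_sphere 0 hr.le θ
    refine intervalIntegral.hasSum_integral_of_dominated_convergence
      (fun k _ => r * Real.exp 1 * (W ^ k / (k.factorial : ℝ))) (fun k => ?_) (fun k => ?_) ?_ ?_ ?_
    · refine Continuous.aestronglyMeasurable ?_
      have he : ∀ θ, Complex.exp (circleMap 0 r θ) - 1 ≠ 0 := fun θ =>
        cexp_sub_one_ne_zero_of_mem_sphere hr hr1 (hmem θ)
      have hcm : Continuous (circleMap 0 r) := continuous_circleMap 0 r
      simp only [deriv_circleMap]
      fun_prop (disch := assumption)
    · refine Eventually.of_forall fun θ _ => ?_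
      have hn : ‖circleMap 0 r θ‖ = r := by simpa using hmem θ
      rw [norm_smul, norm_mul, norm_mul, norm_pow, deriv_circleMap, norm_mul, Complex.norm_I, hn,
        mul_one]
      have h1 : ‖Complex.exp (circleMap 0 r θ)‖ ≤ Real.exp 1 := by
        refine (Complex.norm_exp_le_exp_norm _).trans (Real.exp_le_exp.2 ?_)
        rw [hn]; exact hr1.le
      have h2 := hbound _ (hmem θ)
      rw [norm_div, norm_one, Complex.norm_natCast]
      calc _ ≤ r * (1 / (k.factorial : ℝ) * (Real.exp 1 * W ^ k)) := by gcongr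
        _ = _ := by ring
    · refine Eventually.of_forall fun θ _ => ?_
      exact (Real.summable_pow_div_factorial W).mul_left _
    · exact intervalIntegrable_const
    · refine Eventually.of_forall fun θ _ => ?_
      refine HasSum.const_smul _ ?_
      have := (NormedSpace.expSeries_div_hasSum_exp (1 / (Complex.exp (circleMap 0 r θ) - 1))).mul_left
        (Complex.exp (circleMap 0 r θ))
      rw [← Complex.exp_eq_exp_ℂ, ← Complex.exp_add] at this
      rw [contourIntegrand, one_mul]
      refine this.congr_fun fun k => ?_
      ring
  have e : ∀ k : ℕ, (∫ θ in (0 : ℝ)..(2 * Real.pi), deriv (circleMap 0 r) θ •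
      ((1 / (k.factorial : ℂ)) * (Complex.exp (circleMap 0 r θ) *
        (1 / (Complex.exp (circleMap 0 r θ) - 1)) ^ k))) =
      if k = 1 then 2 * Real.pi * Complex.I else 0 := by
    intro k
    have h1 : (∫ θ in (0 : ℝ)..(2 * Real.pi), deriv (circleMap 0 r) θ •
      ((1 / (k.factorial : ℂ)) * (Complex.exp (circleMap 0 r θ) *
        (1 / (Complex.exp (circleMap 0 r θ) - 1)) ^ k))) =
        (∮ h in C(0, r), (1 / (k.factorial : ℂ)) *
          (Complex.exp h * (1 / (Complex.exp h - 1)) ^ k)) := rfl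
    rw [h1, circleIntegral.integral_const_mul]
    rcases k with _ | _ | k
    · rw [circleIntegral_cexp hr]; simp
    · simp only [zero_add, pow_one, circleIntegral_cexp_div hr hr1]; simp
    · rw [circleIntegral_cexp_div_pow hr hr1]; simp
  simp only [e] at hsum
  exact hsum.unique (hasSum_ite_eq 1 _)

/-- Both sides satisfy the same recurrence. At m = 0 the coefficient of the lowest term vanishes, so
the value at n = 1 alone determines all n ≥ 1. -/
theorem circleIntegral_contourIntegrand_eq {r : ℝ} (hr : 0 < r) (hr1 : r < 1) {n : ℕ}
    (hn : n ≠ 0) :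
    (∮ h in C(0, r), contourIntegrand n h) = 2 * Real.pi * Complex.I * a n := by
  obtain ⟨n, rfl⟩ := Nat.exists_eq_succ_of_ne_zero hn
  clear hn
  induction n using Nat.twoStepInduction with
  | zero =>
    simpa [a_one] using circleIntegral_contourIntegrand_one hr hr1
  | one =>
    have h := circleIntegral_contourIntegrand_recurrence hr hr1 0
    have h1 := circleIntegral_contourIntegrand_one hr hr1
    have ha := a_recurrence 0
    simp only [CharP.cast_eq_zero, zero_add, mul_zero, zero_mul, add_zero, Nat.cast_one, h1,
      a_one] at h ha
    have ha' : (2 : ℂ) * (a 2 : ℂ) = 3 := by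
      have : 2 * a 2 = 3 := by linarith
      exact_mod_cast this
    show (∮ h in C(0, r), contourIntegrand (2 : ℕ) h) = 2 * Real.pi * Complex.I * (a 2 : ℂ)
    linear_combination h / 2 - Real.pi * Complex.I * ha'
  | more n ih0 ih1 =>
    have h := circleIntegral_contourIntegrand_recurrence hr hr1 (n + 1)
    have ha := a_recurrence (n + 1)
    have ha' : (((n + 1 : ℕ) : ℂ) + 2) * (a (n + 1 + 2) : ℂ) -
        (2 * ((n + 1 : ℕ) : ℂ) + 3) * (a (n + 1 + 1) : ℂ) + ((n + 1 : ℕ) : ℂ) * (a (n + 1) : ℂ)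
        = 0 := by
      exact_mod_cast ha
    have hne : (((n + 1 : ℕ) : ℂ) + 2) ≠ 0 := by exact_mod_cast (n + 2).succ_ne_zero
    have e0 : (∮ h in C(0, r), contourIntegrand (n + 1 : ℕ) h) =
      2 * Real.pi * Complex.I * (a (n + 1) : ℂ) := ih0
    have e1 : (∮ h in C(0, r), contourIntegrand (n + 1 + 1 : ℕ) h) =
      2 * Real.pi * Complex.I * (a (n + 1 + 1) : ℂ) := ih1
    rw [e0, e1] at h
    show (∮ h in C(0, r), contourIntegrand (n + 1 + 2 : ℕ) h) =
      2 * Real.pi * Complex.I * (a (n + 1 + 2) : ℂ)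
    refine mul_left_cancel₀ hne ?_
    linear_combination h - 2 * Real.pi * Complex.I * ha'

/-! ### Expansion of the contour integral through I_{i+1}. -/

/-- The integral over the circle of radius `1 / s` that represents `a n` for `n = s ^ 2`. -/
noncomputable def circleMean (s : ℝ) : ℝ :=
  ∫ θ in (0 : ℝ)..(2 * Real.pi), Real.exp (2 * s * Real.cos θ) *
    (circleMap 0 (1 / s) θ * Complex.exp (-μC (circleMap 0 (1 / s) θ))).re

/-- The radius 1/s passes through the saddle points ±1/s of s²h + 1/h and makes this exponent real
on the circle. -/
theorem sq_mul_circleMap_add_inv {s : ℝ} (hs : 0 < s) (θ : ℝ) :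
    (s : ℂ) ^ 2 * circleMap 0 (1 / s) θ + 1 / circleMap 0 (1 / s) θ =
      ((2 * s * Real.cos θ : ℝ) : ℂ) := by
  have hs' : (s : ℂ) ≠ 0 := by exact_mod_cast hs.ne'
  have he := Complex.exp_ne_zero (θ * Complex.I)
  rw [circleMap_zero]
  push_cast
  rw [show 2 * (s : ℂ) * Complex.cos θ = s * (2 * Complex.cos θ) by ring, Complex.two_cos,
    neg_mul, Complex.exp_neg]
  field_simp

theorem circleIntegral_contourIntegrand_sq {s : ℝ} (hs : 1 < s) :
    (∮ h in C(0, 1 / s), contourIntegrand ((s : ℂ) ^ 2) h) =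
      Complex.I * (Real.exp (-(1 / 2)) : ℝ) * ∫ θ in (0 : ℝ)..(2 * Real.pi),
        ((Real.exp (2 * s * Real.cos θ) : ℝ) : ℂ) *
          (circleMap 0 (1 / s) θ * Complex.exp (-μC (circleMap 0 (1 / s) θ))) := by
  rw [circleIntegral, ← intervalIntegral.integral_const_mul]
  refine intervalIntegral.integral_congr fun θ _ => ?_
  have hs0 : 0 < s := by linarith
  have h0 : circleMap 0 (1 / s) θ ≠ 0 := circleMap_ne_center (by positivity)
  simp only [deriv_circleMap, smul_eq_mul, contourIntegrand]
  rw [one_div_cexp_sub_one_eq h0, ← add_sub_assoc, ← add_sub_assoc,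
    sq_mul_circleMap_add_inv hs0, sub_eq_add_neg, sub_eq_add_neg, Complex.exp_add,
    Complex.exp_add, Complex.ofReal_exp, Complex.ofReal_exp]
  push_cast
  ring

theorem continuous_circleMap_mul_exp_neg_μC {s : ℝ} (hs : 1 < s) :
    Continuous fun θ => circleMap 0 (1 / s) θ * Complex.exp (-μC (circleMap 0 (1 / s) θ)) := by
  refine (continuous_circleMap 0 _).mul (Complex.continuous_exp.comp (Continuous.neg ?_))
  refine continuous_iff_continuousAt.2 fun θ => ContinuousAt.comp' ?_
    (continuous_circleMap 0 _).continuousAt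
  refine (differentiableAt_μC ?_).continuousAt
  have hs0 : 0 < s := by linarith
  rw [norm_circleMap_zero, abs_of_pos (by positivity), div_lt_one hs0]
  exact hs

theorem a_eq_circleMean {n : ℕ} {s : ℝ} (hs : 1 < s) (hn : s ^ 2 = n) :
    2 * Real.pi * a n = Real.exp (-(1 / 2)) * circleMean s := by
  have hs0 : 0 < s := by linarith
  have hn0 : n ≠ 0 := by
    rintro rfl
    have : s ^ 2 = 0 := by simpa using hn
    exact hs0.ne' (pow_eq_zero_iff two_ne_zero |>.1 this)
  have h1 := circleIntegral_contourIntegrand_eq (r := 1 / s) (by positivity)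
    ((div_lt_one hs0).2 hs) hn0
  have hnC : (n : ℂ) = (s : ℂ) ^ 2 := by exact_mod_cast hn.symm
  rw [hnC, circleIntegral_contourIntegrand_sq hs] at h1
  set J := ∫ θ in (0 : ℝ)..(2 * Real.pi), ((Real.exp (2 * s * Real.cos θ) : ℝ) : ℂ) *
          (circleMap 0 (1 / s) θ * Complex.exp (-μC (circleMap 0 (1 / s) θ))) with hJ
  have h2 : (Real.exp (-(1 / 2)) : ℝ) * J = ((2 * Real.pi * a n : ℝ) : ℂ) := by
    refine mul_left_cancel₀ Complex.I_ne_zero ?_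
    push_cast at h1 ⊢
    linear_combination h1
  have h3 := congrArg Complex.re h2
  rw [Complex.re_ofReal_mul, Complex.ofReal_re] at h3
  rw [← h3]
  congr 1
  have hint : IntervalIntegrable (fun θ => ((Real.exp (2 * s * Real.cos θ) : ℝ) : ℂ) *
      (circleMap 0 (1 / s) θ * Complex.exp (-μC (circleMap 0 (1 / s) θ)))) volume
      0 (2 * Real.pi) := by
    refine Continuous.intervalIntegrable (Continuous.mul ?_
      (continuous_circleMap_mul_exp_neg_μC hs)) _ _
    exact Complex.continuous_ofReal.comp (by fun_prop)
  have h4 := Complex.reCLM.intervalIntegral_comp_comm hint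
  simp only [Complex.reCLM_apply, Complex.re_ofReal_mul] at h4
  rw [hJ, ← h4, circleMean]

theorem re_circleMap_pow (s θ : ℝ) (i : ℕ) :
    (circleMap 0 (1 / s) θ ^ i).re = (1 / s) ^ i * Real.cos (i * θ) := by
  rw [circleMap_zero, mul_pow, ← Complex.ofReal_pow, Complex.re_ofReal_mul, ← Complex.exp_nat_mul,
    ← mul_assoc, ← Complex.ofReal_natCast, ← Complex.ofReal_mul, Complex.exp_ofReal_mul_I_re]

/-- Each power h^i, with the extra h from dh = i h dθ, yields cos((i+1)θ) and thus I_{i+1}. As the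
exponential weight is positive, the Taylor remainder of exp(-μ), of size s^{-M}, is controlled by
I_0. -/
theorem hasExpansion_circleMean :
    HasExpansion atTop (fun s : ℝ => 1 / s)
      (fun s => √(s / Real.pi) * Real.exp (-(2 * s)) * s * circleMean s)
      (fun m => ∑ i ∈ range (m + 1), expμCoeff i * (-1) ^ i *
        (coshKernelCoeff (i + 1) (m - i) * (-1) ^ (m - i) * gaussianMoment (m - i))) := by
  refine HasExpansion.of_forall_isBigO (e := fun i => expμCoeff i * (-1) ^ i)
    (g := fun i s => √(s / Real.pi) * Real.exp (-(2 * s)) *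
        ∫ φ in (0 : ℝ)..(2 * Real.pi), Real.cos ((i + 1 : ℕ) * φ) * Real.exp (2 * s * Real.cos φ))
    (q := fun i j => coshKernelCoeff (i + 1) j * (-1) ^ j * gaussianMoment j)
    (fun M => ?_) (fun i => hasExpansion_besselI (i + 1))
  obtain ⟨A, hA, hb⟩ := (hasExpansion_exp_neg_μC M).exists_pos
  rw [isBigOWith_iff, Metric.eventually_nhds_iff] at hb
  obtain ⟨δ, hδ, hb⟩ := hb
  refine IsBigO.trans (g := fun s : ℝ => A * ((1 / s) ^ M *
    (√(s / Real.pi) * Real.exp (-(2 * s)) *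
        ∫ φ in (0 : ℝ)..(2 * Real.pi), Real.cos ((0 : ℕ) * φ) * Real.exp (2 * s * Real.cos φ))))
    ?_ ?_
  swap
  · refine IsBigO.const_mul_left ?_ A
    simpa using (isBigO_refl (fun s : ℝ => (1 / s) ^ M) atTop).mul
      (hasExpansion_besselI 0).isBigO_one
  refine IsBigO.of_bound 1 ?_
  filter_upwards [eventually_gt_atTop 1, eventually_gt_atTop (1 / δ)] with s hs hsδ
  have hs0 : 0 < s := by linarith
  have hc0 : Continuous fun θ => Real.exp (2 * s * Real.cos θ) := by fun_prop
  have hc1 : Continuous fun θ => Real.exp (2 * s * Real.cos θ) *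
      (circleMap 0 (1 / s) θ * Complex.exp (-μC (circleMap 0 (1 / s) θ))).re :=
    hc0.mul (Complex.continuous_re.comp (continuous_circleMap_mul_exp_neg_μC hs))
  have hc2 : ∀ i : ℕ, Continuous fun φ => (expμCoeff i * (-1) ^ i * (1 / s) ^ (i + 1)) *
      (Real.cos ((i + 1 : ℕ) * φ) * Real.exp (2 * s * Real.cos φ)) := fun i => by fun_prop
  have e1 : √(s / Real.pi) * Real.exp (-(2 * s)) * s * circleMean s -
      ∑ i ∈ range M, expμCoeff i * (-1) ^ i * (1 / s) ^ i *
        (√(s / Real.pi) * Real.exp (-(2 * s)) *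
          ∫ φ in (0 : ℝ)..(2 * Real.pi),
            Real.cos ((i + 1 : ℕ) * φ) * Real.exp (2 * s * Real.cos φ)) =
      √(s / Real.pi) * Real.exp (-(2 * s)) * s * ∫ θ in (0 : ℝ)..(2 * Real.pi),
        Real.exp (2 * s * Real.cos θ) * (circleMap 0 (1 / s) θ *
          (Complex.exp (-μC (circleMap 0 (1 / s) θ)) -
            ∑ i ∈ range M, (expμCoeff i : ℂ) * (-1) ^ i * circleMap 0 (1 / s) θ ^ i)).re := by
    have e2 : ∀ θ : ℝ, Real.exp (2 * s * Real.cos θ) * (circleMap 0 (1 / s) θ *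
          (Complex.exp (-μC (circleMap 0 (1 / s) θ)) -
            ∑ i ∈ range M, (expμCoeff i : ℂ) * (-1) ^ i * circleMap 0 (1 / s) θ ^ i)).re =
        Real.exp (2 * s * Real.cos θ) *
          (circleMap 0 (1 / s) θ * Complex.exp (-μC (circleMap 0 (1 / s) θ))).re -
        ∑ i ∈ range M, (expμCoeff i * (-1) ^ i * (1 / s) ^ (i + 1)) *
          (Real.cos ((i + 1 : ℕ) * θ) * Real.exp (2 * s * Real.cos θ)) := fun θ => by
      rw [mul_sub, Complex.sub_re, mul_sub, mul_sum, Complex.re_sum, mul_sum]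
      congr 1
      refine sum_congr rfl fun i _ => ?_
      have : circleMap 0 (1 / s) θ * ((expμCoeff i : ℂ) * (-1) ^ i * circleMap 0 (1 / s) θ ^ i) =
          ((expμCoeff i * (-1) ^ i : ℝ) : ℂ) * circleMap 0 (1 / s) θ ^ (i + 1) := by
        push_cast; ring
      rw [this, Complex.re_ofReal_mul, re_circleMap_pow]
      ring
    simp only [e2]
    rw [intervalIntegral.integral_sub (hc1.intervalIntegrable _ _)
      ((continuous_finsetSum _ fun i _ => hc2 i).intervalIntegrable _ _),
      intervalIntegral.integral_finsetSum fun i _ => (hc2 i).intervalIntegrable _ _,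
      mul_sub, mul_sum]
    simp only [intervalIntegral.integral_const_mul, circleMean]
    congr 1
    refine sum_congr rfl fun i _ => ?_
    have : s * (1 / s) = 1 := mul_one_div_cancel hs0.ne'
    rw [pow_succ]
    linear_combination (-(expμCoeff i * (-1) ^ i * (1 / s) ^ i * (√(s / Real.pi) *
      Real.exp (-(2 * s)) * ∫ φ in (0 : ℝ)..(2 * Real.pi),
            Real.cos ((i + 1 : ℕ) * φ) * Real.exp (2 * s * Real.cos φ)))) * this
  rw [e1, one_mul, norm_mul, Real.norm_of_nonneg (by positivity)]
  have e3 : ‖∫ θ in (0 : ℝ)..(2 * Real.pi),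
        Real.exp (2 * s * Real.cos θ) * (circleMap 0 (1 / s) θ *
          (Complex.exp (-μC (circleMap 0 (1 / s) θ)) -
            ∑ i ∈ range M, (expμCoeff i : ℂ) * (-1) ^ i * circleMap 0 (1 / s) θ ^ i)).re‖ ≤
      ∫ φ in (0 : ℝ)..(2 * Real.pi), (1 / s * A * (1 / s) ^ M) *
        (Real.cos ((0 : ℕ) * φ) * Real.exp (2 * s * Real.cos φ)) := by
    refine intervalIntegral.norm_integral_le_of_norm_le (by positivity)
      (Eventually.of_forall fun θ _ => ?_) (Continuous.intervalIntegrable (by fun_prop) _ _)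
    have hn : ‖circleMap 0 (1 / s) θ‖ = 1 / s := by
      rw [norm_circleMap_zero, abs_of_pos (by positivity)]
    have h1 := @hb (circleMap 0 (1 / s) θ) (by
      rw [dist_zero_right, hn]; exact (one_div_lt hs0 hδ).2 hsδ)
    rw [norm_pow, hn] at h1
    rw [norm_mul, Real.norm_of_nonneg (Real.exp_pos _).le, Real.norm_eq_abs, Nat.cast_zero,
      zero_mul, Real.cos_zero, one_mul, mul_comm]
    gcongr
    refine (Complex.abs_re_le_norm _).trans ?_
    rw [norm_mul, hn, mul_assoc]
    gcongr
  rw [intervalIntegral.integral_const_mul] at e3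
  refine (mul_le_mul_of_nonneg_left e3 (by positivity)).trans ((le_abs_self _).trans_eq' ?_)
  have : s * (1 / s) = 1 := mul_one_div_cancel hs0.ne'
  linear_combination -(√(s / Real.pi) * Real.exp (-(2 * s)) * (A * (1 / s) ^ M *
    ∫ φ in (0 : ℝ)..(2 * Real.pi), Real.cos ((0 : ℕ) * φ) * Real.exp (2 * s * Real.cos φ))) * this

/-! ### Combining the two expansions. -/

/-- Substitute i = m - j in the definition of `c`; the factor (2j)! cancels between the kernel
coefficient and the Gaussian moment. -/
theorem neg_one_pow_mul_c (m : ℕ) :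
    (-1) ^ m * c m = ∑ i ∈ range (m + 1), expμCoeff i *
        (coshKernelCoeff (i + 1) (m - i) * gaussianMoment (m - i)) := by
  rw [c, ← mul_assoc, ← mul_pow, neg_one_mul, neg_neg, one_pow, one_mul,
    ← sum_range_reflect]
  refine sum_congr rfl fun i hi => ?_
  have hi : i ≤ m := Nat.lt_succ_iff.1 (mem_range.1 hi)
  obtain ⟨l, rfl⟩ := Nat.exists_eq_add_of_le hi
  rw [show i + l + 1 - 1 - i = l by omega, show i + l - l = i by omega,
    show i + l - i = l by omega, expμCoeff, coshKernelCoeff, gaussianMoment]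
  have e : ((i + l : ℕ) : ℝ) - 2 * (l : ℝ) + 3 / 2 = ((i + 1 : ℕ) : ℝ) - l + 1 / 2 := by
    push_cast; ring
  rw [e]
  have h0 : ((2 * l).factorial : ℝ) ≠ 0 := by positivity
  field_simp

theorem c_eq (m : ℕ) :
    c m = ∑ i ∈ range (m + 1), expμCoeff i * (-1) ^ i *
      (coshKernelCoeff (i + 1) (m - i) * (-1) ^ (m - i) * gaussianMoment (m - i)) := by
  have h : c m = (-1) ^ m * ((-1) ^ m * c m) := by
    rw [← mul_assoc, ← mul_pow, neg_one_mul, neg_neg, one_pow, one_mul]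
  rw [h, neg_one_pow_mul_c, mul_sum]
  refine sum_congr rfl fun i hi => ?_
  have hi : i ≤ m := Nat.lt_succ_iff.1 (mem_range.1 hi)
  obtain ⟨l, rfl⟩ := Nat.exists_eq_add_of_le hi
  rw [show i + l - i = l by omega, pow_add]
  ring

/-- The normalized sequence `-2 n ^ (3 / 2) ρ n`. -/
noncomputable def normρ (n : ℕ) : ℝ := -(2 * (n : ℝ) ^ (3 / 2 : ℝ) * ρ n)

theorem natCast_rpow_three_halves (n : ℕ) : (n : ℝ) ^ (3 / 2 : ℝ) = √n ^ 3 := by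
  rw [Real.sqrt_eq_rpow, ← Real.rpow_natCast, ← Real.rpow_mul (Nat.cast_nonneg n)]
  norm_num

theorem hasExpansion_normρ_sqrt :
    HasExpansion atTop (fun n : ℕ => 1 / √(n : ℝ)) normρ
      (fun m => ∑ i ∈ range (m + 1), c i * ((-1) ^ (m - i) * c (m - i))) := by
  have h := hasExpansion_circleMean.mul hasExpansion_laplace
  simp only [← c_eq, ← neg_one_pow_mul_c] at h
  have ht : Tendsto (fun n : ℕ => √(n : ℝ)) atTop atTop :=
    Real.tendsto_sqrt_atTop.comp tendsto_natCast_atTop_atTop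
  refine (h.comp_tendsto ht).congr' ?_
  -- n ≥ 2 puts the circle of radius 1/√n inside the unit disc, where e^h - 1 vanishes only at 0.
  filter_upwards [eventually_ge_atTop 2] with n hn
  have hsq : √(n : ℝ) ^ 2 = n := Real.sq_sqrt (Nat.cast_nonneg n)
  have hs : 1 < √(n : ℝ) := by
    rw [Real.lt_sqrt zero_le_one, one_pow]
    exact_mod_cast hn
  have ha := a_eq_circleMean hs hsq
  have hb : b n = -laplace n := b_eq (by omega)
  have hl : (∫ h in Set.Ioi (0 : ℝ), Real.exp (-(√(n : ℝ) ^ 2 * h) - 1 / (Real.exp h - 1))) =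
      laplace n := by rw [hsq]; rfl
  rw [normρ, natCast_rpow_three_halves, ρ, hb, hl]
  have hs0 : 0 ≤ √(n : ℝ) := Real.sqrt_nonneg _
  have h1 : √(√(n : ℝ) / Real.pi) * √(√(n : ℝ) / Real.pi) = √(n : ℝ) / Real.pi :=
    Real.mul_self_sqrt (div_nonneg hs0 Real.pi_pos.le)
  have h2 : Real.exp (-(2 * √(n : ℝ))) * Real.exp (2 * √(n : ℝ)) = 1 := by
    rw [← Real.exp_add]; simp
  have hpi := Real.pi_pos.ne'
  generalize √(n : ℝ) = s at *
  calc _ = (√(s / Real.pi) * √(s / Real.pi)) * (Real.exp (-(2 * s)) * Real.exp (2 * s)) * s ^ 2 *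
        (Real.exp (-(1 / 2)) * circleMean s) * laplace n := by ring
    _ = s / Real.pi * s ^ 2 * (2 * Real.pi * a n) * laplace n := by rw [h1, h2, ha]; ring
    _ = _ := by field_simp

theorem convolution_even (k : ℕ) :
    ∑ i ∈ range (2 * k + 1), c i * ((-1) ^ (2 * k - i) * c (2 * k - i)) = d k := by
  rw [d]
  refine sum_congr rfl fun i hi => ?_
  have hi : i ≤ 2 * k := Nat.lt_succ_iff.1 (mem_range.1 hi)
  have : (-1 : ℝ) ^ (2 * k - i) = (-1) ^ i := by
    have h1 : (-1 : ℝ) ^ (2 * k - i) * (-1) ^ i = 1 := by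
      rw [← pow_add, Nat.sub_add_cancel hi, pow_mul]; simp
    have h2 : (-1 : ℝ) ^ i * (-1) ^ i = 1 := by rw [← mul_pow]; simp
    calc _ = (-1 : ℝ) ^ (2 * k - i) * ((-1) ^ i * (-1) ^ i) := by rw [h2, mul_one]
      _ = _ := by rw [← mul_assoc, h1, one_mul]
  rw [this]
  ring

/-- The reflection i ↦ 2k + 1 - i changes the sign of the sum. -/
theorem convolution_odd (k : ℕ) :
    ∑ i ∈ range (2 * k + 1 + 1), c i * ((-1) ^ (2 * k + 1 - i) * c (2 * k + 1 - i)) = 0 := by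
  have h := sum_range_reflect
    (fun i => c i * ((-1) ^ (2 * k + 1 - i) * c (2 * k + 1 - i))) (2 * k + 1 + 1)
  have h2 : ∑ i ∈ range (2 * k + 1 + 1), c (2 * k + 1 + 1 - 1 - i) *
      ((-1) ^ (2 * k + 1 - (2 * k + 1 + 1 - 1 - i)) * c (2 * k + 1 - (2 * k + 1 + 1 - 1 - i))) =
      ∑ i ∈ range (2 * k + 1 + 1), -(c i * ((-1) ^ (2 * k + 1 - i) * c (2 * k + 1 - i))) := by
    refine sum_congr rfl fun i hi => ?_
    have hi : i ≤ 2 * k + 1 := Nat.lt_succ_iff.1 (mem_range.1 hi)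
    rw [show 2 * k + 1 + 1 - 1 - i = 2 * k + 1 - i by omega,
      show 2 * k + 1 - (2 * k + 1 - i) = i by omega]
    have : (-1 : ℝ) ^ (2 * k + 1 - i) = -(-1) ^ i := by
      have h1 : (-1 : ℝ) ^ (2 * k + 1 - i) * (-1) ^ i = -1 := by
        rw [← pow_add, Nat.sub_add_cancel hi, pow_succ, pow_mul]; simp
      have h2 : (-1 : ℝ) ^ i * (-1) ^ i = 1 := by rw [← mul_pow]; simp
      calc _ = (-1 : ℝ) ^ (2 * k + 1 - i) * ((-1) ^ i * (-1) ^ i) := by rw [h2, mul_one]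
        _ = _ := by rw [← mul_assoc, h1, neg_one_mul]
    rw [this]
    ring
  rw [h2, sum_neg_distrib] at h
  linarith

theorem hasExpansion_normρ :
    HasExpansion atTop (fun n : ℕ => 1 / (n : ℝ)) normρ d := by
  intro M
  have hsq : ∀ n : ℕ, (1 / √(n : ℝ)) ^ 2 = 1 / n := fun n => by
    rw [one_div_pow, Real.sq_sqrt (Nat.cast_nonneg n)]
  -- Order 2M in 1/√n is order M in 1/n, since the odd terms vanish.
  refine (hasExpansion_normρ_sqrt (2 * M)).congr (fun n => ?_) fun n => ?_
  · congr 1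
    induction M with
    | zero => simp
    | succ M ih =>
      beta_reduce at ih ⊢
      rw [show 2 * (M + 1) = 2 * M + 1 + 1 by ring, sum_range_succ, sum_range_succ, ih,
        convolution_even, convolution_odd, zero_mul, add_zero, pow_mul, hsq, sum_range_succ]
  · rw [pow_mul, hsq]

theorem hasPoincareExpansion_normρ : HasPoincareExpansion normρ d := fun m _ =>
  (hasExpansion_normρ m).congr (fun n => by simp [div_eq_mul_inv]) fun n => by simp

theorem c_zero : c 0 = 1 := by
  simp [c, coeffAtZero, μ]

theorem d_zero : d 0 = 1 := by
  simp [d, c_zero]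

/-! ### Third-order recurrence for `ρ` and the recursion for `d`. -/

theorem b_recurrence {m : ℕ} (hm : 1 ≤ m) :
    ((m : ℝ) + 2) * b (m + 2) - (2 * m + 3) * b (m + 1) + m * b m = 0 := by
  rw [b_eq (by omega), b_eq (by omega), b_eq (by omega)]
  linear_combination -laplace_recurrence hm

/-- The third order recurrence satisfied by the products of the solutions of a second order
recurrence. -/
theorem ρ_recurrence {m : ℕ} (hm : 1 ≤ m) {x : ℝ} (hx : x = m + 3) :
    (2 * x - 3) * (x - 1) * x * (x * ρ (m + 3)) -
      (2 * x - 1) * (3 * x ^ 2 - 5 * x + 1) * ((x - 1) * ρ (m + 2)) +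
      (2 * x - 3) * (3 * x ^ 2 - 5 * x + 1) * ((x - 2) * ρ (m + 1)) -
      (2 * x - 1) * (x - 2) * (x - 3) * ((x - 3) * ρ m) = 0 := by
  have ha0 := a_recurrence m
  have ha1 := a_recurrence (m + 1)
  have hb0 := b_recurrence hm
  have hb1 := b_recurrence (m := m + 1) (by omega)
  have hm' : (m : ℝ) = x - 3 := by rw [hx]; ring
  have hx1 : x - 1 ≠ 0 := by
    rw [show x - 1 = m + 2 by rw [hx]; ring]
    positivity
  have hx0 : x ≠ 0 := by rw [hx]; positivity
  push_cast at ha1 hb1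
  rw [show m + 1 + 2 = m + 3 by ring, show m + 1 + 1 = m + 2 by ring] at ha1 hb1
  rw [hm'] at ha0 ha1 hb0 hb1
  have a2 : a (m + 2) = ((2 * x - 3) * a (m + 1) - (x - 3) * a m) / (x - 1) := by
    rw [eq_div_iff hx1]; linear_combination ha0
  have b2 : b (m + 2) = ((2 * x - 3) * b (m + 1) - (x - 3) * b m) / (x - 1) := by
    rw [eq_div_iff hx1]; linear_combination hb0
  have a3 : a (m + 3) = ((2 * x - 1) * a (m + 2) - (x - 2) * a (m + 1)) / x := by
    rw [eq_div_iff hx0]; linear_combination ha1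
  have b3 : b (m + 3) = ((2 * x - 1) * b (m + 2) - (x - 2) * b (m + 1)) / x := by
    rw [eq_div_iff hx0]; linear_combination hb1
  simp only [ρ]
  rw [a3, b3, a2, b2]
  field_simp
  ring

/-- The polynomial multiplying `ρ n` in the recurrence for `ρ`. -/
noncomputable def A (h : ℝ) : ℝ := 2 - 5 * h + 3 * h ^ 2

/-- The power n^{3/2} in the normalization leaves (n-i)ρ(n-i) times a factor √n common to all
shifts. The recurrence for ρ, written in xρ(x), thus passes to `normρ` with coefficients polynomial
in 1/n. -/
theorem normρ_mul_rpow {n i : ℕ} (hi : i < n) :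
    (1 - (i : ℝ) * (1 / n)) ^ (-(1 / 2) : ℝ) * normρ (n - i) =
      -2 * √n * ((n - i) * ρ (n - i)) := by
  have hn : (0 : ℝ) < n := by exact_mod_cast (Nat.zero_le i).trans_lt hi
  have hni : (0 : ℝ) < n - i := by
    have : (i : ℝ) < n := by exact_mod_cast hi
    linarith
  have e : 1 - (i : ℝ) * (1 / n) = (n - i) / n := by field_simp
  rw [normρ, natCast_rpow_three_halves, Nat.cast_sub hi.le, e, Real.rpow_neg (by positivity),
    ← Real.sqrt_eq_rpow, Real.sqrt_div hni.le]
  have h1 : √((n : ℝ) - i) ^ 2 = n - i := Real.sq_sqrt hni.le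
  have h2 : √((n : ℝ) - i) ≠ 0 := (Real.sqrt_pos.2 hni).ne'
  have h3 : √(n : ℝ) ≠ 0 := (Real.sqrt_pos.2 hn).ne'
  field_simp
  rw [h1]

theorem normρ_recurrence {n : ℕ} (hn : 4 ≤ n) :
    A (1 / n) * ((1 - ((0 : ℕ) : ℝ) * (1 / n)) ^ (-(1 / 2) : ℝ) * normρ (n - 0)) +
      B (1 / n) * ((1 - ((1 : ℕ) : ℝ) * (1 / n)) ^ (-(1 / 2) : ℝ) * normρ (n - 1)) +
      C (1 / n) * ((1 - ((2 : ℕ) : ℝ) * (1 / n)) ^ (-(1 / 2) : ℝ) * normρ (n - 2)) +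
      D (1 / n) * ((1 - ((3 : ℕ) : ℝ) * (1 / n)) ^ (-(1 / 2) : ℝ) * normρ (n - 3)) = 0 := by
  rw [normρ_mul_rpow (by omega), normρ_mul_rpow (by omega), normρ_mul_rpow (by omega),
    normρ_mul_rpow (by omega)]
  obtain ⟨m, rfl⟩ : ∃ m, n = m + 3 := ⟨n - 3, by omega⟩
  have h := ρ_recurrence (m := m) (by omega) rfl
  have hx : ((m : ℝ) + 3) ≠ 0 := by positivity
  rw [show m + 3 - 0 = m + 3 by omega, show m + 3 - 1 = m + 2 by omega,
    show m + 3 - 2 = m + 1 by omega, show m + 3 - 3 = m by omega]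
  push_cast
  generalize (m : ℝ) + 3 = x at *
  have e : ∀ r0 r1 r2 r3 : ℝ, A (1 / x) * (-2 * √x * ((x - 0) * r0)) +
      B (1 / x) * (-2 * √x * ((x - 1) * r1)) + C (1 / x) * (-2 * √x * ((x - 2) * r2)) +
      D (1 / x) * (-2 * √x * ((x - 3) * r3)) = -2 * √x / x ^ 3 *
      ((2 * x - 3) * (x - 1) * x * (x * r0) -
      (2 * x - 1) * (3 * x ^ 2 - 5 * x + 1) * ((x - 1) * r1) +
      (2 * x - 3) * (3 * x ^ 2 - 5 * x + 1) * ((x - 2) * r2) -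
      (2 * x - 1) * (x - 2) * (x - 3) * ((x - 3) * r3)) := fun r0 r1 r2 r3 => by
    simp only [A, B, C, D]
    field_simp
    ring
  rw [e, h, mul_zero]

/-- The Maclaurin coefficients of `(1 - i h) ^ (-(j + 1 / 2))`. -/
noncomputable def powCoeff (i j l : ℕ) : ℝ :=
  Ring.choose (-((j : ℝ) + 1 / 2)) l * (-(i : ℝ)) ^ l

theorem hasExpansion_one_sub_mul_rpow (i j : ℕ) :
    HasExpansion (𝓝 0) (fun h => h) (fun h : ℝ => (1 - (i : ℝ) * h) ^ (-((j : ℝ) + 1 / 2)))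
      (powCoeff i j) := by
  have ht : Tendsto (fun x : ℝ => (-(i : ℝ)) * x) (𝓝 0) (𝓝 0) := by
    have : Continuous fun x : ℝ => (-(i : ℝ)) * x := by fun_prop
    simpa using this.tendsto 0
  refine ((hasExpansion_one_add_rpow (-((j : ℝ) + 1 / 2))).comp_tendsto ht).scale.congr'
    (Eventually.of_forall fun h => ?_)
  simp only [neg_mul, ← sub_eq_add_neg]

theorem powCoeff_zero (i j : ℕ) : powCoeff i j 0 = 1 := by simp [powCoeff]

theorem powCoeff_one (i j : ℕ) : powCoeff i j 1 = (j + 1 / 2) * i := by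
  simp [powCoeff]
  ring

theorem powCoeff_two (i j : ℕ) :
    powCoeff i j 2 = (j + 1 / 2) * (j + 3 / 2) / 2 * (i : ℝ) ^ 2 := by
  rw [powCoeff, ringChoose_succ _ 1, Ring.choose_one_right]
  push_cast
  ring

theorem powCoeff_zero_left (j : ℕ) {l : ℕ} (hl : l ≠ 0) : powCoeff 0 j l = 0 := by
  simp [powCoeff, hl]

/-- The Maclaurin coefficients of
`(p₀ + p₁ h + p₂ h ^ 2 + p₃ h ^ 3) (1 - i h) ^ (-(j + 1 / 2))`. -/
noncomputable def cubicCoeff (p₀ p₁ p₂ p₃ : ℝ) (i j l : ℕ) : ℝ :=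
  p₀ * powCoeff i j l + p₁ * (if l < 1 then 0 else powCoeff i j (l - 1)) +
    p₂ * (if l < 2 then 0 else powCoeff i j (l - 2)) +
    p₃ * (if l < 3 then 0 else powCoeff i j (l - 3))

theorem hasExpansion_cubic {P : ℝ → ℝ} {p₀ p₁ p₂ p₃ : ℝ}
    (hP : ∀ h, P h = p₀ + p₁ * h + p₂ * h ^ 2 + p₃ * h ^ 3) (i j : ℕ) :
    HasExpansion (𝓝 0) (fun h => h) (fun h : ℝ => P h * (1 - (i : ℝ) * h) ^ (-((j : ℝ) + 1 / 2)))
      (cubicCoeff p₀ p₁ p₂ p₃ i j) := by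
  have h := hasExpansion_one_sub_mul_rpow i j
  refine ((((h.const_mul p₀).add ((h.pow_mul isBigO_id_one 1).const_mul p₁)).add
    ((h.pow_mul isBigO_id_one 2).const_mul p₂)).add
    ((h.pow_mul isBigO_id_one 3).const_mul p₃)).congr' (Eventually.of_forall fun x => ?_)
  simp only [hP]
  ring

theorem tendsto_one_div_natCast : Tendsto (fun n : ℕ => 1 / (n : ℝ)) atTop (𝓝 0) :=
  tendsto_one_div_atTop_nhds_zero_nat

/-- Since (n-i)^{-j} = n^{-j} (1 - i/n)^{-j}, the shifted series is an expansion in 1/n with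
n-dependent coefficients, and the extra power -1/2 produces the exponent -(j + 1/2). -/
theorem hasExpansion_shift {P : ℝ → ℝ} {p₀ p₁ p₂ p₃ : ℝ}
    (hP : ∀ h, P h = p₀ + p₁ * h + p₂ * h ^ 2 + p₃ * h ^ 3) (i : ℕ) :
    HasExpansion atTop (fun n : ℕ => 1 / (n : ℝ))
      (fun n => P (1 / n) * ((1 - (i : ℝ) * (1 / n)) ^ (-(1 / 2) : ℝ) * normρ (n - i)))
      (fun m => ∑ j ∈ range (m + 1), d j * cubicCoeff p₀ p₁ p₂ p₃ i j (m - j)) := by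
  have hg : ∀ j : ℕ, HasExpansion atTop (fun n : ℕ => 1 / (n : ℝ))
      (fun n => P (1 / n) * (1 - (i : ℝ) * (1 / n)) ^ (-((j : ℝ) + 1 / 2)))
      (cubicCoeff p₀ p₁ p₂ p₃ i j) := fun j =>
    (hasExpansion_cubic hP i j).comp_tendsto tendsto_one_div_natCast
  refine HasExpansion.of_forall_isBigO (fun M => ?_) hg
  have h1 := (hasExpansion_normρ M).comp_tendsto (tendsto_sub_atTop_nat i)
  have hsmall : (fun n : ℕ => 1 / ((n - i : ℕ) : ℝ)) =O[atTop] fun n : ℕ => 1 / (n : ℝ) := by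
    refine IsBigO.of_bound (i + 1) ?_
    filter_upwards [eventually_gt_atTop i] with n hn
    have hn0 : (0 : ℝ) < n := by exact_mod_cast (Nat.zero_le i).trans_lt hn
    have hni : (1 : ℝ) ≤ n - i := by
      have : ((i + 1 : ℕ) : ℝ) ≤ n := by exact_mod_cast hn
      push_cast at this
      linarith
    rw [Nat.cast_sub hn.le, Real.norm_of_nonneg (by positivity), Real.norm_of_nonneg (by positivity),
      mul_one_div, div_le_div_iff₀ (by linarith) hn0]
    have : (0 : ℝ) ≤ i := Nat.cast_nonneg i
    nlinarith
  have h0 : (fun n : ℕ => P (1 / n) * (1 - (i : ℝ) * (1 / n)) ^ (-(1 / 2) : ℝ))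
      =O[atTop] fun _ => (1 : ℝ) := by
    simpa using (hg 0).isBigO_one
  refine ((h0.mul (h1.trans (hsmall.pow M))).congr' ?_ (Eventually.of_forall fun n => one_mul _))
  filter_upwards [eventually_gt_atTop i] with n hn
  have hn0 : (0 : ℝ) < n := by exact_mod_cast (Nat.zero_le i).trans_lt hn
  have hni : (0 : ℝ) < n - i := by
    have : (i : ℝ) < n := by exact_mod_cast hn
    linarith
  have e : 1 - (i : ℝ) * (1 / n) = (n - i) / n := by field_simp
  have hpos : (0 : ℝ) < 1 - (i : ℝ) * (1 / n) := by rw [e]; positivity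
  simp only [Function.comp_apply]
  rw [mul_sub, mul_sum, mul_assoc]
  congr 1
  refine sum_congr rfl fun j _ => ?_
  have e2 : (1 - (i : ℝ) * (1 / n)) ^ (-((j : ℝ) + 1 / 2)) =
      ((1 - (i : ℝ) * (1 / n)) ^ j)⁻¹ * (1 - (i : ℝ) * (1 / n)) ^ (-(1 / 2) : ℝ) := by
    rw [neg_add, Real.rpow_add hpos, Real.rpow_neg hpos.le, Real.rpow_natCast]
  have e3 : (1 / (n : ℝ)) ^ j * ((1 - (i : ℝ) * (1 / n)) ^ j)⁻¹ = (1 / ((n - i : ℕ) : ℝ)) ^ j := by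
    rw [← inv_pow, ← mul_pow, e, Nat.cast_sub hn.le]
    congr 1
    field_simp
  rw [e2, ← e3]
  ring

theorem A_eq (h : ℝ) : A h = 2 + -5 * h + 3 * h ^ 2 + 0 * h ^ 3 := by rw [A]; ring

theorem B_eq (h : ℝ) : B h = -6 + 13 * h + -7 * h ^ 2 + 1 * h ^ 3 := by rw [B]; ring

theorem C_eq (h : ℝ) : C h = 6 + -19 * h + 17 * h ^ 2 + -3 * h ^ 3 := by rw [C]; ring

theorem D_eq (h : ℝ) : D h = -2 + 11 * h + -17 * h ^ 2 + 6 * h ^ 3 := by rw [D]; ring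

/-- The Maclaurin coefficients of the factor of `d j` in the recursion. -/
noncomputable def recCoeff (j l : ℕ) : ℝ :=
  cubicCoeff (-6) 13 (-7) 1 1 j l + cubicCoeff 6 (-19) 17 (-3) 2 j l +
    cubicCoeff (-2) 11 (-17) 6 3 j l

/-- The recurrence says that a sum of four shifted expansions is eventually 0; uniqueness makes
every coefficient 0. -/
theorem sum_d_mul_coeff_eq_zero (m : ℕ) :
    ∑ j ∈ range (m + 1), d j * (cubicCoeff 2 (-5) 3 0 0 j (m - j) + recCoeff j (m - j)) = 0 := by
  have h := (((hasExpansion_shift A_eq 0).add (hasExpansion_shift B_eq 1)).add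
    (hasExpansion_shift C_eq 2)).add (hasExpansion_shift D_eq 3)
  have h0 : HasExpansion atTop (fun n : ℕ => 1 / (n : ℝ)) (fun _ => (0 : ℝ)) _ := h.congr' (by
    filter_upwards [eventually_ge_atTop 4] with n hn
    exact normρ_recurrence hn)
  have h1 := congrFun (h0.unique tendsto_one_div_natCast (by
    filter_upwards [eventually_gt_atTop 0] with n hn
    have : (0 : ℝ) < n := by exact_mod_cast hn
    positivity) HasExpansion.zero) m
  simp only [← sum_add_distrib, ← mul_add] at h1
  refine Eq.trans (sum_congr rfl fun j _ => ?_) h1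
  rw [recCoeff]
  ring

theorem coeff_sum_zero (j : ℕ) : cubicCoeff 2 (-5) 3 0 0 j 0 + recCoeff j 0 = 0 := by
  simp [recCoeff, cubicCoeff, powCoeff_zero]

theorem coeff_sum_one (j : ℕ) : cubicCoeff 2 (-5) 3 0 0 j 1 + recCoeff j 1 = 0 := by
  simp [recCoeff, cubicCoeff, powCoeff_zero, powCoeff_one]
  ring

theorem coeff_sum_two (j : ℕ) : cubicCoeff 2 (-5) 3 0 0 j 2 + recCoeff j 2 = 8 * j := by
  simp [recCoeff, cubicCoeff, powCoeff_zero, powCoeff_one, powCoeff_two]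
  ring

theorem coeff_A_eq_zero (j : ℕ) {l : ℕ} (hl : 3 ≤ l) : cubicCoeff 2 (-5) 3 0 0 j l = 0 := by
  rw [cubicCoeff, powCoeff_zero_left j (by omega), powCoeff_zero_left j (by omega),
    powCoeff_zero_left j (by omega)]
  simp

/-- In the relation of order k + 2, the indices k + 2 and k + 1 drop out and k gives 8k d k. For j <
k the remaining order is at least 3, beyond the degree of A. -/
theorem eight_mul_d (k : ℕ) :
    8 * (k : ℝ) * d k = -∑ j ∈ range k, d j * recCoeff j (k + 2 - j) := by
  have h := sum_d_mul_coeff_eq_zero (k + 2)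
  rw [sum_range_succ, sum_range_succ, sum_range_succ, show k + 2 - k = 2 by omega,
    show k + 2 - (k + 1) = 1 by omega, Nat.sub_self, coeff_sum_zero, coeff_sum_one,
    coeff_sum_two, mul_zero, mul_zero, add_zero, add_zero] at h
  rw [sum_congr rfl fun j hj => by
    rw [coeff_A_eq_zero j (by have := mem_range.1 hj; omega), zero_add]] at h
  linarith

theorem analyticAt_one_sub_mul_rpow (i : ℝ) (r : ℝ) :
    AnalyticAt ℝ (fun h : ℝ => (1 - i * h) ^ r) 0 := by
  have h1 : AnalyticAt ℝ (fun h : ℝ => -(i * h)) 0 := by fun_prop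
  exact (Real.one_add_rpow_hasFPowerSeriesAt_zero (a := r)).analyticAt.comp_of_eq h1 (by simp)

theorem coeffAtZero_recursion (k : ℕ) :
    coeffAtZero (k + 2) (fun h : ℝ => ∑ j ∈ range k, d j * h ^ j *
      (B h * (1 - h) ^ (-((j : ℝ) + 1 / 2)) + C h * (1 - 2 * h) ^ (-((j : ℝ) + 1 / 2)) +
        D h * (1 - 3 * h) ^ (-((j : ℝ) + 1 / 2)))) =
      ∑ j ∈ range k, d j * recCoeff j (k + 2 - j) := by
  have hrec : ∀ j : ℕ, HasExpansion (𝓝 0) (fun h => h)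
      (fun h : ℝ => B h * (1 - h) ^ (-((j : ℝ) + 1 / 2)) +
        C h * (1 - 2 * h) ^ (-((j : ℝ) + 1 / 2)) + D h * (1 - 3 * h) ^ (-((j : ℝ) + 1 / 2)))
      (recCoeff j) := fun j => by
    have h := ((hasExpansion_cubic B_eq 1 j).add (hasExpansion_cubic C_eq 2 j)).add
      (hasExpansion_cubic D_eq 3 j)
    simp only [Nat.cast_one, one_mul, Nat.cast_ofNat] at h
    exact h
  have hE := HasExpansion.finset_sum (range k) fun j _ =>
    ((hrec j).pow_mul isBigO_id_one j).const_mul (d j)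
  rw [coeffAtZero_eq ?_ ((hE.congr' ?_).mono nhdsWithin_le_nhds)]
  · refine sum_congr rfl fun j hj => ?_
    rw [if_neg (by have := mem_range.1 hj; omega)]
  · have hB : AnalyticAt ℝ B 0 := by unfold B; fun_prop
    have hC : AnalyticAt ℝ C 0 := by unfold C; fun_prop
    have hD : AnalyticAt ℝ D 0 := by unfold D; fun_prop
    refine Finset.analyticAt_fun_sum _ fun j _ => ?_
    have h1 := analyticAt_one_sub_mul_rpow 1 (-((j : ℝ) + 1 / 2))
    simp only [one_mul] at h1
    exact AnalyticAt.mul (by fun_prop) (((hB.mul h1).add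
      (hC.mul (analyticAt_one_sub_mul_rpow 2 _))).add (hD.mul (analyticAt_one_sub_mul_rpow 3 _)))
  · refine Eventually.of_forall fun h => ?_
    simp only [mul_assoc]

end BGG

theorem lemma4 :
    -- the `d_k` are the coefficients of the asymptotic series of `-2 n^{3/2} ρ_n`
    BGG.HasPoincareExpansion (fun n : ℕ => -(2 * (n : ℝ) ^ (3 / 2 : ℝ) * BGG.ρ n)) BGG.d ∧
    BGG.d 0 = 1 ∧
    (∀ k : ℕ, 1 ≤ k →
      8 * (k : ℝ) * BGG.d k =
        -BGG.coeffAtZero (k + 2) (fun h : ℝ =>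
          ∑ j ∈ Finset.range k, BGG.d j * h ^ j *
            (BGG.B h * (1 - h) ^ (-((j : ℝ) + 1 / 2)) +
             BGG.C h * (1 - 2 * h) ^ (-((j : ℝ) + 1 / 2)) +
             BGG.D h * (1 - 3 * h) ^ (-((j : ℝ) + 1 / 2))))) ∧
    (∀ h : ℝ,
      BGG.B h = -((2 - h) * (3 - 5 * h + h ^ 2)) ∧
      BGG.C h = (2 - 3 * h) * (3 - 5 * h + h ^ 2) ∧
      BGG.D h = -((1 - 2 * h) * (1 - 3 * h) * (2 - h))) := by
  refine ⟨BGG.hasPoincareExpansion_normρ, BGG.d_zero, fun k _ => ?_, fun h => ⟨?_, ?_, ?_⟩⟩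
  · rw [BGG.coeffAtZero_recursion, BGG.eight_mul_d]
  · rw [BGG.B]; ring
  · rw [BGG.C]; ring
  · rw [BGG.D]; ring
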